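/- **Theorem 2.4.** Let $\mathcal L$ be the class of equations $$u_t=F\,u_{xx}+G\,u_{yy}+H\,u_{xy}+K,$$ where the tuple of arbitrary elements $\theta=(F,G,H,K)$ runs through the set $\mathcal S$ of quadruples of smooth real functions of $(t,x,y,u,u_x,u_y)$, each quadruple defined on an open set, with $FG-H^2/4\neq0$ there. An equation of the class is regarded as a subset $\mathcal L_\theta$ of the space of second-order jets. Point transformations are smooth diffeomorphisms between open sets. The equivalence groupoid $\mathcal G^\sim$ of $\mathcal L$ consists of the triples $(\theta,\xi,\theta')$ with $\theta,\theta'\in\mathcal S$ and $\xi$ a point transformation in the space of $(t,x,y,u)$, over every point of whose domain $\theta$ is defined somewhere, such that a second-order jet at which the prolongation of $\xi$ is defined lies in $\mathcal L_\theta$ if and only if its image lies in $\mathcal L_{\theta'}$. The usual equivalence group $G^\sim$ is the pseudogroup of point transformations $\Xi$ in the space of $(t,x,y,u,u_t,u_x,u_y,F,G,H,K)$ that are projectable to point transformations in the spaces of $(t,x,y,u,u_t,u_x,u_y)$ and of $(t,x,y,u)$, preserve the contact structure of the space of $(t,x,y,u,u_t,u_x,u_y)$, and preserve the class. The last condition means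 that for each $\theta\in\mathcal S$ there is a $\theta'\in\mathcal S$ such that $\Xi$ maps the part in its domain of the graph of $\theta$ (regarded as a subset of this space, with $u_t$ free) onto the part in its range of the graph of $\theta'$, and such that, over the part of the graph of $\theta$ in the domain of $\Xi$, the second prolongation of $\xi=\Xi|_{(t,x,y,u)}$ maps $\mathcal L_\theta$ to $\mathcal L_{\theta'}$, again in the sense that a jet lies in $\mathcal L_\theta$ if and only if its image lies in $\mathcal L_{\theta'}$. Then the following hold. 1. The class $\mathcal L$ is normalized in the usual sense: for every $(\theta,\xi,\theta')\in\mathcal G^\sim$ there is $\Xi\in G^\sim$ with $\xi=\Xi|_{(t,x,y,u)}$ and $\theta'=\Xi_*\theta$. The latter equality means that $\Xi$ is defined on, and maps, the part of the graph of $\theta$ over the jets at which the prolongation of $\xi$ is defined onto the part of the graph of $\theta'$ over the jets at which the prolongation of $\xi^{-1}$ is defined. 2. A point transformation $\Xi$ in the space of $(t,x,y,u,u_t,u_x,u_y,F,G,H,K)$ belongs to $G^\sim$ if and only if the following conditions hold. * Its $(t,x,y,u)$-components define a point transformation $\xi$ of the form $$t'=T(t),\quad x'=X(t,x,y,u),\quad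 y'=Y(t,x,y,u),\quad u'=U(t,x,y,u),\qquad T_t\left|\frac{\partial(X,Y,U)}{\partial(x,y,u)}\right|\neq0,$$ where $T=T(t)$ is understood locally on the domain of $\xi$. * Its $(u_t,u_x,u_y)$-components $(u'_{t'},u'_{x'},u'_{y'})$ are those given by the chain rule, that is, $D_\mu U=u'_{t'}D_\mu T+u'_{x'}D_\mu X+u'_{y'}D_\mu Y$ for $\mu\in\{t,x,y\}$, where $D_\mu=\partial_\mu+u_\mu\partial_u$. * Its $(F,G,H,K)$-components are given, with $\zeta=U-u'_{x'}X-u'_{y'}Y$, where $u'_{x'}$ and $u'_{y'}$ are regarded as constants in the partial derivatives of $\zeta$ (and $\zeta_u\ne0$ automatically), by $$\begin{aligned} F'={}&\tfrac{1}{T_t\zeta_u^2}\big[(X_x\zeta_u-X_u\zeta_x)^2F+(X_y\zeta_u-X_u\zeta_y)^2G+(X_x\zeta_u-X_u\zeta_x)(X_y\zeta_u-X_u\zeta_y)H\big],\\ G'={}&\tfrac{1}{T_t\zeta_u^2}\big[(Y_x\zeta_u-Y_u\zeta_x)^2F+(Y_y\zeta_u-Y_u\zeta_y)^2G+(Y_x\zeta_u-Y_u\zeta_x)(Y_y\zeta_u-Y_u\zeta_y)H\big],\\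 H'={}&\tfrac{1}{T_t\zeta_u^2}\big[2(X_x\zeta_u-X_u\zeta_x)(Y_x\zeta_u-Y_u\zeta_x)F+2(X_y\zeta_u-X_u\zeta_y)(Y_y\zeta_u-Y_u\zeta_y)G\\ &+\big((X_x\zeta_u-X_u\zeta_x)(Y_y\zeta_u-Y_u\zeta_y)+(X_y\zeta_u-X_u\zeta_y)(Y_x\zeta_u-Y_u\zeta_x)\big)H\big],\\ K'={}&\tfrac1{T_t}\Big[\Big(-\zeta_{xx}+\tfrac{2\zeta_x\zeta_{xu}}{\zeta_u}-\tfrac{\zeta_x^2\zeta_{uu}}{\zeta_u^2}\Big)F+\Big(-\zeta_{yy}+\tfrac{2\zeta_y\zeta_{yu}}{\zeta_u}-\tfrac{\zeta_y^2\zeta_{uu}}{\zeta_u^2}\Big)G\\ &+\Big(-\zeta_{xy}+\tfrac{\zeta_x\zeta_{yu}+\zeta_y\zeta_{xu}}{\zeta_u}-\tfrac{\zeta_x\zeta_y\zeta_{uu}}{\zeta_u^2}\Big)H+\zeta_uK+\zeta_t\Big]. \end{aligned}$$ 3. Every point transformation $\xi$ of the form in item 2 is the $(t,x,y,u)$-part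 of some $\Xi\in G^\sim$ that is defined for all values of $(F,G,H,K)$ over all first-order jets at which the prolongation of $\xi$ is defined. -/

import Mathlib

open scoped ContDiff Topology

namespace EvolClass

/-! Spaces.  The independent variables `(t, x, y)` are indexed by `0, 1, 2 : Fin 3`. -/

/-- The space with coordinates `((t, x, y), u)`. -/
abbrev Base := (Fin 3 → ℝ) × ℝ

/-- The space with coordinates `(((t, x, y), u), (u_t, u_x, u_y))`. -/
abbrev Jet1 := Base × (Fin 3 → ℝ)

/-- The space with coordinates `(t, x, y, u, u_x, u_y)`, on which the arbitrary elements live. -/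
abbrev Args := Base × ℝ × ℝ

/-- The space with coordinates `(t, x, y, u, u_t, u_x, u_y, F, G, H, K)`. -/
abbrev Ext := Jet1 × (Fin 4 → ℝ)

/-- Forgetting `u_t`. -/
def args (j : Jet1) : Args := (j.1, j.2 1, j.2 2)

/-! Local diffeomorphisms. -/

/-- A homeomorphism between open subsets of `E` that is smooth together with its inverse. -/
def IsSmooth {E : Type*} [NormedAddCommGroup E] [NormedSpace ℝ E]
    (e : OpenPartialHomeomorph E E) : Prop :=
  ContDiffOn ℝ ∞ e e.source ∧ ContDiffOn ℝ ∞ e.symm e.target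

/-- `Φ` is projectable to the first factor, with projection the local diffeomorphism `φ`. -/
def ProjectsTo {E E' : Type*} [NormedAddCommGroup E] [NormedSpace ℝ E] [TopologicalSpace E']
    (Φ : OpenPartialHomeomorph (E × E') (E × E')) (φ : OpenPartialHomeomorph E E) : Prop :=
  IsSmooth φ ∧ φ.source = Prod.fst '' Φ.source ∧ ∀ z ∈ Φ.source, φ z.1 = (Φ z).1

/-! Partial and total derivatives. -/

/-- Coordinate directions `∂_t`, `∂_x`, `∂_y` (for `μ = 0, 1, 2`) of the base space. -/
def ind (μ : Fin 3) : Base := (Pi.single μ 1, 0)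

/-- The coordinate direction `∂_u` of the base space. -/
def dep : Base := (0, 1)

/-- Directional derivative `∂_a f` at `w`. -/
noncomputable def pd (f : Base → ℝ) (a w : Base) : ℝ := fderiv ℝ f w a

/-- Second directional derivative `∂_a ∂_b f` at `w`. -/
noncomputable def pd2 (f : Base → ℝ) (a b w : Base) : ℝ := fderiv ℝ (fderiv ℝ f) w a b

/-- Total derivative `D_μ f = f_μ + u_μ f_u` of a function of `(t, x, y, u)`, where `p μ` is the
value of `u_μ`. -/
noncomputable def tot (f : Base → ℝ) (w : Base) (p : Fin 3 → ℝ) (μ : Fin 3) : ℝ :=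
  pd f (ind μ + p μ • dep) w

/-- Second total derivative
`D_μ D_ν f = f_μν + u_ν f_μu + u_μ f_νu + u_μ u_ν f_uu + u_μν f_u`, where `p μ`, `s μ ν` are the
values of `u_μ`, `u_μν`. -/
noncomputable def tot2 (f : Base → ℝ) (w : Base) (p : Fin 3 → ℝ) (s : Matrix (Fin 3) (Fin 3) ℝ)
    (μ ν : Fin 3) : ℝ :=
  pd2 f (ind μ + p μ • dep) (ind ν + p ν • dep) w + s μ ν * pd f dep w

/-- The components `T, X, Y` (for `a = 0, 1, 2`) of a transformation of the base space. -/
def indC (ξ : OpenPartialHomeomorph Base Base) (a : Fin 3) (w : Base) : ℝ := (ξ w).1 a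

/-- The component `U` of a transformation of the base space. -/
def depC (ξ : OpenPartialHomeomorph Base Base) (w : Base) : ℝ := (ξ w).2

/-! Prolongation of point transformations, by the chain rule. -/

/-- The first prolongation of `ξ` maps the jet `j` to `j'`: the identity `u'(t', x', y') = U`
differentiated once, `D_μ U = ∑ₐ u'ₐ D_μ Xᵃ` with `(X⁰, X¹, X²) = (T, X, Y)`. -/
def Prolong1 (ξ : OpenPartialHomeomorph Base Base) (j j' : Jet1) : Prop :=
  j.1 ∈ ξ.source ∧ j'.1 = ξ j.1 ∧
    ∀ μ, tot (depC ξ) j.1 j.2 μ = ∑ a, j'.2 a * tot (indC ξ a) j.1 j.2 μ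

/-- The second prolongation of `ξ` maps the jet `(j, s)` to `(j', s')`: the identity
`u'(t', x', y') = U` differentiated once and twice. -/
def Prolong2 (ξ : OpenPartialHomeomorph Base Base) (j : Jet1) (s : Matrix (Fin 3) (Fin 3) ℝ)
    (j' : Jet1) (s' : Matrix (Fin 3) (Fin 3) ℝ) : Prop :=
  Prolong1 ξ j j' ∧
    ∀ μ ν, tot2 (depC ξ) j.1 j.2 s μ ν =
      ∑ a, j'.2 a * tot2 (indC ξ a) j.1 j.2 s μ ν +
        ∑ a, ∑ b, s' a b * tot (indC ξ a) j.1 j.2 μ * tot (indC ξ b) j.1 j.2 ν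

/-- The set of first-order jets on which the prolongation of `ξ` is defined. -/
def prolongDomain (ξ : OpenPartialHomeomorph Base Base) : Set Jet1 :=
  {j | ∃ j', Prolong1 ξ j j'}

/-! The class of equations. -/

/-- A value `θ = (F, G, H, K)` of the tuple of arbitrary elements: smooth functions of
`(t, x, y, u, u_x, u_y)` on an open set, with `F G - H² / 4 ≠ 0` there. The components are numbered
`0, 1, 2, 3`; the values of `toFun` outside `dom` carry no meaning. -/
structure ArbElem where
  dom : Set Args
  isOpen_dom : IsOpen dom
  toFun : Args → Fin 4 → ℝ
  smooth : ContDiffOn ℝ ∞ toFun dom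
  nondeg : ∀ z ∈ dom, toFun z 0 * toFun z 1 - toFun z 2 ^ 2 / 4 ≠ 0

/-- The equation `u_t = F u_xx + G u_yy + H u_xy + K` as a set of second-order jets. -/
def Eqn (θ : ArbElem) : Set (Jet1 × Matrix (Fin 3) (Fin 3) ℝ) :=
  {q | q.2.IsSymm ∧ args q.1 ∈ θ.dom ∧
    q.1.2 0 = θ.toFun (args q.1) 0 * q.2 1 1 + θ.toFun (args q.1) 1 * q.2 2 2 +
      θ.toFun (args q.1) 2 * q.2 1 2 + θ.toFun (args q.1) 3}

/-- The graph of `θ` in the space with coordinates `(t, x, y, u, u_t, u_x, u_y, F, G, H, K)`. -/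
def graph (θ : ArbElem) : Set Ext :=
  {z | args z.1 ∈ θ.dom ∧ z.2 = θ.toFun (args z.1)}

/-- The equivalence groupoid: the triples `(θ, ξ, θ')` where `ξ` is a point transformation between
open subsets of the space of `(t, x, y, u)`, the equation of `θ` is defined above each point of the
domain of `ξ`, and the prolongation of `ξ` maps the equation of `θ` to that of `θ'`. -/
def equivalenceGroupoid : Set (ArbElem × OpenPartialHomeomorph Base Base × ArbElem) :=
  {q | IsSmooth q.2.1 ∧ (∀ w ∈ q.2.1.source, ∃ z ∈ q.1.dom, z.1 = w) ∧
    ∀ j s j' s', s.IsSymm → s'.IsSymm → Prolong2 q.2.1 j s j' s' →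
      ((j, s) ∈ Eqn q.1 ↔ (j', s') ∈ Eqn q.2.2)}

/-! The usual equivalence group. -/

/-- The contact form `du - u_t dt - u_x dx - u_y dy` at `j`, evaluated at the tangent vector `η`. -/
def contactForm (j η : Jet1) : ℝ := η.1.2 - ∑ μ, j.2 μ * η.1.1 μ

/-- Preservation of the contact structure. -/
def IsContact (φ : OpenPartialHomeomorph Jet1 Jet1) : Prop :=
  ∀ j ∈ φ.source, ∀ η, contactForm j η = 0 → contactForm (φ j) (fderiv ℝ φ j η) = 0

/-- `Ξ`, with projection `ξ` to the base space, preserves the class: it transforms each tuple `θ` of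
arbitrary elements to some tuple `θ'` and, over the part of `θ` that lies in the domain of `Ξ`, the
equation of `θ` to the equation of `θ'`. -/
def PreservesClass (Ξ : OpenPartialHomeomorph Ext Ext) (ξ : OpenPartialHomeomorph Base Base) :
    Prop :=
  ∀ θ : ArbElem, ∃ θ' : ArbElem,
    Ξ '' (graph θ ∩ Ξ.source) = graph θ' ∩ Ξ.target ∧
    ∀ j s j' s', (j, θ.toFun (args j)) ∈ graph θ ∩ Ξ.source → s.IsSymm → s'.IsSymm →
      Prolong2 ξ j s j' s' → ((j, s) ∈ Eqn θ ↔ (j', s') ∈ Eqn θ')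

/-- The usual equivalence (pseudo)group: local diffeomorphisms of the space with coordinates
`(t, x, y, u, u_t, u_x, u_y, F, G, H, K)` that are projectable to `(t, x, y, u, u_t, u_x, u_y)` and
to `(t, x, y, u)`, are consistent with the contact structure and preserve the class. -/
def equivalenceGroup : Set (OpenPartialHomeomorph Ext Ext) :=
  {Ξ | IsSmooth Ξ ∧ ∃ (φ : OpenPartialHomeomorph Jet1 Jet1) (ξ : OpenPartialHomeomorph Base Base),
    ProjectsTo Ξ φ ∧ ProjectsTo φ ξ ∧ IsContact φ ∧ PreservesClass Ξ ξ}

/-- `ξ = Ξ|_(t,x,y,u)`. -/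
def RestrictsTo (Ξ : OpenPartialHomeomorph Ext Ext) (ξ : OpenPartialHomeomorph Base Base) : Prop :=
  ξ.source = (fun z : Ext => z.1.1) '' Ξ.source ∧ ∀ z ∈ Ξ.source, ξ z.1.1 = (Ξ z).1.1

/-- The part of the graph of `θ` on which the prolongation of `ξ` is defined. -/
def graphOver (θ : ArbElem) (ξ : OpenPartialHomeomorph Base Base) : Set Ext :=
  {z ∈ graph θ | z.1 ∈ prolongDomain ξ}

/-- The class is normalized: each `(θ, ξ, θ')` in the equivalence groupoid is induced by some `Ξ` in
the equivalence group, `ξ = Ξ|_(t,x,y,u)` and `θ' = Ξ_* θ`, the latter for the parts of `θ` and `θ'`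
on which the prolongations of `ξ` and of its inverse are defined. -/
def IsNormalized : Prop :=
  ∀ θ ξ θ', (θ, ξ, θ') ∈ equivalenceGroupoid →
    ∃ Ξ ∈ equivalenceGroup, RestrictsTo Ξ ξ ∧
      graphOver θ ξ ⊆ Ξ.source ∧ Ξ '' graphOver θ ξ = graphOver θ' ξ.symm

/-! The explicit form of the transformations. -/

/-- Point transformations `t' = T(t)`, `x' = X(t,x,y,u)`, `y' = Y(t,x,y,u)`, `u' = U(t,x,y,u)` with
`T_t |∂(X,Y,U)/∂(x,y,u)| ≠ 0`. As the domain is an arbitrary open set, `T = T(t)` is understood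
locally. -/
def HasBaseForm (ξ : OpenPartialHomeomorph Base Base) : Prop :=
  IsSmooth ξ ∧ ∀ w ∈ ξ.source,
    (∃ τ : ℝ → ℝ, ∀ᶠ w' in 𝓝 w, indC ξ 0 w' = τ (w'.1 0)) ∧
    pd (indC ξ 0) (ind 0) w *
      Matrix.det !![pd (indC ξ 1) (ind 1) w, pd (indC ξ 1) (ind 2) w, pd (indC ξ 1) dep w;
                    pd (indC ξ 2) (ind 1) w, pd (indC ξ 2) (ind 2) w, pd (indC ξ 2) dep w;
                    pd (depC ξ) (ind 1) w, pd (depC ξ) (ind 2) w, pd (depC ξ) dep w] ≠ 0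

/-- `ζ = U - u'_{x'} X - u'_{y'} Y` as a function of `(t, x, y, u)`, where the values `q = u'_{x'}`
and `r = u'_{y'}` are regarded as constants. -/
def zeta (ξ : OpenPartialHomeomorph Base Base) (q r : ℝ) (w : Base) : ℝ :=
  depC ξ w - q * indC ξ 1 w - r * indC ξ 2 w

/-- The transformed values `(F', G', H', K')` of the arbitrary elements `v = (F, G, H, K)` at a jet
over `w` where `q = u'_{x'}` and `r = u'_{y'}`. -/
noncomputable def elemTransform (ξ : OpenPartialHomeomorph Base Base) (w : Base) (q r : ℝ)
    (v : Fin 4 → ℝ) : Fin 4 → ℝ :=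
  let F := v 0
  let G := v 1
  let H := v 2
  let K := v 3
  let Tt := pd (indC ξ 0) (ind 0) w
  let Xx := pd (indC ξ 1) (ind 1) w
  let Xy := pd (indC ξ 1) (ind 2) w
  let Xu := pd (indC ξ 1) dep w
  let Yx := pd (indC ξ 2) (ind 1) w
  let Yy := pd (indC ξ 2) (ind 2) w
  let Yu := pd (indC ξ 2) dep w
  let ζ := zeta ξ q r
  let ζt := pd ζ (ind 0) w
  let ζx := pd ζ (ind 1) w
  let ζy := pd ζ (ind 2) w
  let ζu := pd ζ dep w
  let ζxx := pd2 ζ (ind 1) (ind 1) w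
  let ζyy := pd2 ζ (ind 2) (ind 2) w
  let ζxy := pd2 ζ (ind 1) (ind 2) w
  let ζxu := pd2 ζ (ind 1) dep w
  let ζyu := pd2 ζ (ind 2) dep w
  let ζuu := pd2 ζ dep dep w
  ![1 / (Tt * ζu ^ 2) *
      ((Xx * ζu - Xu * ζx) ^ 2 * F + (Xy * ζu - Xu * ζy) ^ 2 * G +
        (Xx * ζu - Xu * ζx) * (Xy * ζu - Xu * ζy) * H),
    1 / (Tt * ζu ^ 2) *
      ((Yx * ζu - Yu * ζx) ^ 2 * F + (Yy * ζu - Yu * ζy) ^ 2 * G +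
        (Yx * ζu - Yu * ζx) * (Yy * ζu - Yu * ζy) * H),
    1 / (Tt * ζu ^ 2) *
      (2 * (Xx * ζu - Xu * ζx) * (Yx * ζu - Yu * ζx) * F +
        2 * (Xy * ζu - Xu * ζy) * (Yy * ζu - Yu * ζy) * G +
        ((Xx * ζu - Xu * ζx) * (Yy * ζu - Yu * ζy) +
          (Xy * ζu - Xu * ζy) * (Yx * ζu - Yu * ζx)) * H),
    1 / Tt *
      ((-ζxx + 2 * ζx * ζxu / ζu - ζx ^ 2 * ζuu / ζu ^ 2) * F +
        (-ζyy + 2 * ζy * ζyu / ζu - ζy ^ 2 * ζuu / ζu ^ 2) * G +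
        (-ζxy + (ζx * ζyu + ζy * ζxu) / ζu - ζx * ζy * ζuu / ζu ^ 2) * H +
        ζu * K + ζt)]

/-- The transformations whose `(t, x, y, u)`-components are a point transformation of the above
form, whose `(u_t, u_x, u_y)`-components are given by the chain rule and whose
`(F, G, H, K)`-components are given by the above formulas. -/
def HasEquivalenceForm (Ξ : OpenPartialHomeomorph Ext Ext) : Prop :=
  IsSmooth Ξ ∧ ∃ ξ, HasBaseForm ξ ∧ RestrictsTo Ξ ξ ∧ ∀ z ∈ Ξ.source,
    Prolong1 ξ z.1 (Ξ z).1 ∧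
    (Ξ z).2 = elemTransform ξ z.1.1 ((Ξ z).1.2 1) ((Ξ z).1.2 2) z.2

end EvolClass

/-!
Everything rests on three facts about a point transformation `ξ = (T, X, Y, U)` and its prolongation.

*Contact planes.* The chain rule for first derivatives says that the differential of `ξ` pulls the
contact covector `du' - ∑ u'_a dx'^a` back to a nonzero multiple of `du - ∑ u_μ dx^μ`
(`Prolong1.contactCov_fderiv`). This condition is symmetric in `ξ` and `ξ⁻¹`, so the prolongation is a
local diffeomorphism given by explicit formulas in the derivative of `ξ⁻¹` (`prolong`). Likewise any
transformation of first-order jets that preserves the contact structure and projects to `ξ` is the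
prolongation of `ξ` (`IsContact.prolong1`). Second derivatives transform by
`C + κ s = Aᵀ s' A` with `A = (D_μ Xᵃ)` invertible and `κ ≠ 0` (`prolong2_iff`), so that the symmetric
matrices `s` and `s'` of second derivatives correspond bijectively.

*Necessity of `T = T(t)`.* If the prolongation maps one nondegenerate equation to another at a jet,
then changing `s'` by `e₀ vᵀ + v e₀ᵀ` does not affect the image equation, since the derivatives
`u'_{t'a'}` do not occur in it. Pulled back, this says that the symbol of the original equation
annihilates `(D_t T, D_x T, D_y T)`, whence `D_x T = D_y T = 0` (`MapsEqnAt.tot_time_eq_zero`). As this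
holds on an open set of values of `(u_x, u_y)`, where the prolongable jets are dense, it follows that
`T_x = T_y = T_u = 0` (`hasBaseForm_of_tot_time`).

*The transformation formulas.* When `T = T(t)`, the defects of an equation with the values `v` and of
the equation with the values `v'` given by the stated formulas are proportional, with factor
`ζ_u / T_t` (`HasBaseForm.defect_eq`). So these formulas do map equations to equations. Conversely they
are forced (`HasBaseForm.eq_affElem`): changing `u_t` changes `u'_{t'}` but neither the other derivatives
nor the arbitrary elements, and two different level sets determine an affine function of `s'`. For a
transformation in the equivalence group the argument is applied to constant arbitrary elements;
values with `F G - H² / 4 = 0`, where it says nothing, are reached by continuity. For sufficiency,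
the image of a tuple of arbitrary elements is constructed in `pushforward`, and the formulas, being
affine and invertible in `(F, G, H, K)`, define a local diffeomorphism on the largest possible domain
(`equivTransform`), which serves for the normalization of the class as well.
-/

namespace EvolClass

/-! ### Prolongation of point transformations to first-order jets -/

/-- The contact covector `du - ∑ p_μ dx^μ` on the base space determined by the values `p` of the
first derivatives. -/
noncomputable def contactCov (p : Fin 3 → ℝ) : Base →L[ℝ] ℝ :=
  ContinuousLinearMap.snd ℝ _ _ -
    ∑ μ, p μ • (ContinuousLinearMap.proj μ).comp (ContinuousLinearMap.fst ℝ (Fin 3 → ℝ) ℝ)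

lemma contactCov_apply (p : Fin 3 → ℝ) (h : Base) :
    contactCov p h = h.2 - ∑ μ, p μ * h.1 μ := by
  simp [contactCov]

lemma contactCov_dep (p : Fin 3 → ℝ) : contactCov p dep = 1 := by
  simp [contactCov_apply, dep]

lemma contactCov_ind (p : Fin 3 → ℝ) (μ : Fin 3) : contactCov p (ind μ) = -p μ := by
  simp [contactCov_apply, ind, Pi.single_apply]

lemma contactCov_tangent (p : Fin 3 → ℝ) (μ : Fin 3) : contactCov p (ind μ + p μ • dep) = 0 := by
  simp [contactCov_dep, contactCov_ind]

lemma contactForm_eq (j η : Jet1) : contactForm j η = contactCov j.2 η.1 :=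
  (contactCov_apply _ _).symm

lemma base_decomp (p : Fin 3 → ℝ) (h : Base) :
    h = ∑ μ, h.1 μ • (ind μ + p μ • dep) + contactCov p h • dep := by
  apply Prod.ext
  · funext i
    fin_cases i <;>
      simp [ind, dep, contactCov_apply, Fin.sum_univ_three]
  · simp [ind, dep, contactCov_apply, Fin.sum_univ_three]
    ring

/-- A covector that annihilates the contact plane is a multiple of the contact covector. -/
lemma eq_mul_contactCov (p : Fin 3 → ℝ) (L : Base →L[ℝ] ℝ)
    (hL : ∀ μ, L (ind μ + p μ • dep) = 0) (h : Base) : L h = L dep * contactCov p h := by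
  conv_lhs => rw [base_decomp p h]
  have h0 : ∀ μ, L (h.1 μ • (ind μ + p μ • dep)) = 0 := fun μ => by rw [L.map_smul, hL, smul_zero]
  rw [map_add, map_sum, Finset.sum_eq_zero fun μ _ => h0 μ, L.map_smul, zero_add, smul_eq_mul,
    mul_comm]

section Components

variable {ξ : OpenPartialHomeomorph Base Base} {w : Base}

lemma IsSmooth.symm {E : Type*} [NormedAddCommGroup E] [NormedSpace ℝ E]
    {e : OpenPartialHomeomorph E E} (he : IsSmooth e) : IsSmooth e.symm :=
  ⟨he.2, he.1⟩

lemma IsSmooth.contDiffAt {E : Type*} [NormedAddCommGroup E] [NormedSpace ℝ E]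
    {e : OpenPartialHomeomorph E E} (he : IsSmooth e) {w : E} (hw : w ∈ e.source) :
    ContDiffAt ℝ ∞ e w :=
  he.1.contDiffAt (e.open_source.mem_nhds hw)

lemma IsSmooth.differentiableAt {E : Type*} [NormedAddCommGroup E] [NormedSpace ℝ E]
    {e : OpenPartialHomeomorph E E} (he : IsSmooth e) {w : E} (hw : w ∈ e.source) :
    DifferentiableAt ℝ e w :=
  (he.contDiffAt hw).differentiableAt (by simp)

lemma IsSmooth.contDiffAt_indC (hξ : IsSmooth ξ) (hw : w ∈ ξ.source) (a : Fin 3) :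
    ContDiffAt ℝ ∞ (indC ξ a) w :=
  contDiffAt_pi.1 (contDiffAt_fst.comp w (hξ.contDiffAt hw)) a

lemma IsSmooth.contDiffAt_depC (hξ : IsSmooth ξ) (hw : w ∈ ξ.source) :
    ContDiffAt ℝ ∞ (depC ξ) w :=
  contDiffAt_snd.comp w (hξ.contDiffAt hw)

lemma IsSmooth.pd_indC (hξ : IsSmooth ξ) (hw : w ∈ ξ.source) (a : Fin 3) (h : Base) :
    pd (indC ξ a) h w = (fderiv ℝ ξ w h).1 a := by
  have := (hξ.differentiableAt hw).hasFDerivAt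
  have h2 := (((ContinuousLinearMap.proj (R := ℝ) (φ := fun _ : Fin 3 => ℝ) a).comp
    (ContinuousLinearMap.fst ℝ (Fin 3 → ℝ) ℝ)).hasFDerivAt (x := ξ w)).comp w this
  have h3 : fderiv ℝ (indC ξ a) w = _ := h2.fderiv
  simp [pd, h3]

lemma IsSmooth.pd_depC (hξ : IsSmooth ξ) (hw : w ∈ ξ.source) (h : Base) :
    pd (depC ξ) h w = (fderiv ℝ ξ w h).2 := by
  have := (hξ.differentiableAt hw).hasFDerivAt
  have h2 := ((ContinuousLinearMap.snd ℝ (Fin 3 → ℝ) ℝ).hasFDerivAt (x := ξ w)).comp w this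
  have h3 : fderiv ℝ (depC ξ) w = _ := h2.fderiv
  simp [pd, h3]

end Components

section Inverse

variable {E : Type*} [NormedAddCommGroup E] [NormedSpace ℝ E] {e : OpenPartialHomeomorph E E}

lemma IsSmooth.fderiv_symm_comp (he : IsSmooth e) {w : E} (hw : w ∈ e.source) (h : E) :
    fderiv ℝ e.symm (e w) (fderiv ℝ e w h) = h := by
  have h1 := (he.differentiableAt hw).hasFDerivAt
  have h2 := (he.symm.differentiableAt (e.map_source hw)).hasFDerivAt
  have h3 := h2.comp w h1
  have h4 : HasFDerivAt (e.symm ∘ e) (ContinuousLinearMap.id ℝ E) w :=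
    (hasFDerivAt_id w).congr_of_eventuallyEq (e.eventually_left_inverse hw)
  exact DFunLike.congr_fun (h3.unique h4) h

lemma IsSmooth.fderiv_comp_symm (he : IsSmooth e) {w : E} (hw : w ∈ e.source) (h : E) :
    fderiv ℝ e w (fderiv ℝ e.symm (e w) h) = h := by
  have := he.symm.fderiv_symm_comp (e.map_source hw) h
  rwa [e.symm_symm, e.left_inv hw] at this

end Inverse

variable {ξ : OpenPartialHomeomorph Base Base} {j j' : Jet1}

/-- The chain rule for the first derivatives says that the contact planes correspond. -/
lemma prolong1_iff_contactCov (hξ : IsSmooth ξ) :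
    Prolong1 ξ j j' ↔ j.1 ∈ ξ.source ∧ j'.1 = ξ j.1 ∧
      ∀ μ, contactCov j'.2 (fderiv ℝ ξ j.1 (ind μ + j.2 μ • dep)) = 0 := by
  refine and_congr_right fun hw => and_congr_right fun _ => forall_congr' fun μ => ?_
  simp only [tot, hξ.pd_depC hw, hξ.pd_indC hw, contactCov_apply, sub_eq_zero]

lemma Prolong1.contactCov_fderiv (hξ : IsSmooth ξ) (h : Prolong1 ξ j j') (η : Base) :
    contactCov j'.2 (fderiv ℝ ξ j.1 η) =
      contactCov j'.2 (fderiv ℝ ξ j.1 dep) * contactCov j.2 η :=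
  eq_mul_contactCov j.2 ((contactCov j'.2).comp (fderiv ℝ ξ j.1))
    ((prolong1_iff_contactCov hξ).1 h).2.2 η

/-- The conformal factor of the contact covectors does not vanish. -/
lemma Prolong1.contactCov_fderiv_dep_ne (hξ : IsSmooth ξ) (h : Prolong1 ξ j j') :
    contactCov j'.2 (fderiv ℝ ξ j.1 dep) ≠ 0 := by
  intro h0
  have := h.contactCov_fderiv hξ (fderiv ℝ ξ.symm (ξ j.1) dep)
  rw [hξ.fderiv_comp_symm h.1, contactCov_dep, h0, zero_mul] at this
  exact one_ne_zero this

lemma Prolong1.symm (hξ : IsSmooth ξ) (h : Prolong1 ξ j j') : Prolong1 ξ.symm j' j := by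
  rw [prolong1_iff_contactCov hξ.symm]
  refine ⟨h.2.1 ▸ ξ.map_source h.1, by rw [h.2.1, ξ.left_inv h.1], fun a => ?_⟩
  have := h.contactCov_fderiv hξ (fderiv ℝ ξ.symm (ξ j.1) (ind a + j'.2 a • dep))
  rw [hξ.fderiv_comp_symm h.1, contactCov_tangent] at this
  rw [h.2.1]
  exact (mul_eq_zero.1 this.symm).resolve_left (h.contactCov_fderiv_dep_ne hξ)

lemma prolong1_symm_iff (hξ : IsSmooth ξ) : Prolong1 ξ.symm j' j ↔ Prolong1 ξ j j' :=
  ⟨fun h => by simpa using h.symm hξ.symm, fun h => h.symm hξ⟩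

/-- The first prolongation as a map. The contact covector at the image is proportional to the
pullback of the contact covector `ω` by `η = ξ⁻¹`, whence `u'_a = -ω(η_* ∂_a) / ω(η_* ∂_u)`.
The values are meaningful only where the denominator does not vanish. -/
noncomputable def prolongMap (ξ : OpenPartialHomeomorph Base Base) (j : Jet1) : Jet1 :=
  (ξ j.1, fun a => -contactCov j.2 (fderiv ℝ ξ.symm (ξ j.1) (ind a)) /
    contactCov j.2 (fderiv ℝ ξ.symm (ξ j.1) dep))

lemma prolong1_iff (hξ : IsSmooth ξ) : Prolong1 ξ j j' ↔
    (j.1 ∈ ξ.source ∧ contactCov j.2 (fderiv ℝ ξ.symm (ξ j.1) dep) ≠ 0) ∧ j' = prolongMap ξ j := by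
  constructor
  · intro h
    have hs := h.symm hξ
    have hne := hs.contactCov_fderiv_dep_ne hξ.symm
    have hc := hs.contactCov_fderiv hξ.symm
    rw [h.2.1] at hne hc
    refine ⟨⟨h.1, hne⟩, Prod.ext h.2.1 (funext fun a => ?_)⟩
    have := hc (ind a)
    rw [contactCov_ind] at this
    simp only [prolongMap, this]
    field_simp
  · rintro ⟨⟨hw, hne⟩, rfl⟩
    rw [← prolong1_symm_iff hξ, prolong1_iff_contactCov hξ.symm]
    refine ⟨ξ.map_source hw, (ξ.left_inv hw).symm, fun a => ?_⟩
    simp only [prolongMap, map_add, map_smul, smul_eq_mul]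
    field_simp
    ring

lemma mem_prolongDomain_iff (hξ : IsSmooth ξ) : j ∈ prolongDomain ξ ↔
    j.1 ∈ ξ.source ∧ contactCov j.2 (fderiv ℝ ξ.symm (ξ j.1) dep) ≠ 0 := by
  simp [prolongDomain, prolong1_iff hξ]

lemma prolong1_prolongMap (hξ : IsSmooth ξ) (hj : j ∈ prolongDomain ξ) :
    Prolong1 ξ j (prolongMap ξ j) :=
  (prolong1_iff hξ).2 ⟨(mem_prolongDomain_iff hξ).1 hj, rfl⟩

lemma Prolong1.eq_prolongMap (hξ : IsSmooth ξ) (h : Prolong1 ξ j j') : j' = prolongMap ξ j :=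
  ((prolong1_iff hξ).1 h).2

lemma contDiffOn_contactCov_symm (hξ : IsSmooth ξ) (h : Base) :
    ContDiffOn ℝ ∞ (fun j : Jet1 => contactCov j.2 (fderiv ℝ ξ.symm (ξ j.1) h))
      (Prod.fst ⁻¹' ξ.source) := by
  have h1 : ContDiffOn ℝ ∞ (fderiv ℝ ξ.symm) ξ.target :=
    hξ.2.fderiv_of_isOpen ξ.open_target (by simp)
  have h2 : ContDiffOn ℝ ∞ (fun j : Jet1 => ξ j.1) (Prod.fst ⁻¹' ξ.source) :=
    hξ.1.comp contDiff_fst.contDiffOn fun _ h => h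
  have h3 : ContDiffOn ℝ ∞ (fun j : Jet1 => fderiv ℝ ξ.symm (ξ j.1) h) (Prod.fst ⁻¹' ξ.source) :=
    (h1.comp h2 fun _ h => ξ.map_source h).clm_apply contDiffOn_const
  simp only [contactCov_apply]
  refine h3.snd.sub (ContDiffOn.sum fun μ _ => ContDiffOn.mul ?_ ?_)
  · exact (contDiff_apply ℝ ℝ μ).comp_contDiffOn contDiff_snd.contDiffOn
  · exact (contDiff_apply ℝ ℝ μ).comp_contDiffOn h3.fst

lemma isOpen_prolongDomain (hξ : IsSmooth ξ) : IsOpen (prolongDomain ξ) := by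
  have : prolongDomain ξ = (Prod.fst ⁻¹' ξ.source) ∩
      (fun j : Jet1 => contactCov j.2 (fderiv ℝ ξ.symm (ξ j.1) dep)) ⁻¹' {0}ᶜ := by
    ext j
    exact mem_prolongDomain_iff hξ
  rw [this]
  exact (contDiffOn_contactCov_symm hξ dep).continuousOn.isOpen_inter_preimage
    (ξ.open_source.preimage continuous_fst) isOpen_compl_singleton

lemma contDiffOn_prolongMap (hξ : IsSmooth ξ) :
    ContDiffOn ℝ ∞ (prolongMap ξ) (prolongDomain ξ) := by
  have hsub : prolongDomain ξ ⊆ Prod.fst ⁻¹' ξ.source := fun j hj =>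
    ((mem_prolongDomain_iff hξ).1 hj).1
  refine ContDiffOn.prodMk (hξ.1.comp contDiff_fst.contDiffOn hsub) (contDiffOn_pi.2 fun a => ?_)
  exact (((contDiffOn_contactCov_symm hξ (ind a)).mono hsub).neg).div
    ((contDiffOn_contactCov_symm hξ dep).mono hsub) fun j hj => ((mem_prolongDomain_iff hξ).1 hj).2

/-- The first prolongation as a local diffeomorphism of the space of first-order jets. -/
noncomputable def prolong (ξ : OpenPartialHomeomorph Base Base) (hξ : IsSmooth ξ) :
    OpenPartialHomeomorph Jet1 Jet1 where
  toFun := prolongMap ξ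
  invFun := prolongMap ξ.symm
  source := prolongDomain ξ
  target := prolongDomain ξ.symm
  map_source' j hj := ⟨j, (prolong1_prolongMap hξ hj).symm hξ⟩
  map_target' j hj := ⟨j, by simpa using (prolong1_prolongMap hξ.symm hj).symm hξ.symm⟩
  left_inv' _ hj := (((prolong1_prolongMap hξ hj).symm hξ).eq_prolongMap hξ.symm).symm
  right_inv' _ hj :=
    (((prolong1_symm_iff hξ).1 (prolong1_prolongMap hξ.symm hj)).eq_prolongMap hξ).symm
  open_source := isOpen_prolongDomain hξ
  open_target := isOpen_prolongDomain hξ.symm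
  continuousOn_toFun := (contDiffOn_prolongMap hξ).continuousOn
  continuousOn_invFun := (contDiffOn_prolongMap hξ.symm).continuousOn

lemma isSmooth_prolong (hξ : IsSmooth ξ) : IsSmooth (prolong ξ hξ) :=
  ⟨contDiffOn_prolongMap hξ, contDiffOn_prolongMap hξ.symm⟩

/-- The jets over a given point at which the prolongation of `ξ` is defined are dense: they are
given by an affine inequation `ω(η_* ∂_u) ≠ 0` in the values of the derivatives. -/
lemma exists_mem_prolongDomain (hξ : IsSmooth ξ) {w : Base} (hw : w ∈ ξ.source)
    {O : Set (Fin 3 → ℝ)} (hO : IsOpen O) (hne : O.Nonempty) :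
    ∃ p ∈ O, (w, p) ∈ prolongDomain ξ := by
  obtain ⟨p, hp⟩ := hne
  set k := fderiv ℝ ξ.symm (ξ w) dep with hk
  by_cases h0 : contactCov p k = 0
  · have hk1 : ∃ μ, k.1 μ ≠ 0 := by
      by_contra! hcon
      have h2 : k.2 = 0 := by simpa [contactCov_apply, hcon] using h0
      have h3 : k = 0 := Prod.ext (funext hcon) h2
      have h4 := hξ.fderiv_comp_symm hw dep
      rw [← hk, h3, map_zero] at h4
      simpa [dep] using congrArg Prod.snd h4
    obtain ⟨μ, hμ⟩ := hk1
    have hc : Filter.Tendsto (fun ε : ℝ => p + ε • (Pi.single μ 1 : Fin 3 → ℝ)) (𝓝[≠] 0) (𝓝 p) := by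
      have : Continuous (fun ε : ℝ => p + ε • (Pi.single μ 1 : Fin 3 → ℝ)) := by fun_prop
      simpa using (this.tendsto 0).mono_left nhdsWithin_le_nhds
    obtain ⟨ε, h1, h2⟩ := ((hc.eventually (hO.mem_nhds hp)).and self_mem_nhdsWithin).exists
    refine ⟨_, h1, (mem_prolongDomain_iff hξ).2 ⟨hw, ?_⟩⟩
    rw [contactCov_apply] at h0
    have h3 : contactCov (p + ε • (Pi.single μ 1 : Fin 3 → ℝ)) k = -(ε * k.1 μ) := by
      simp only [contactCov_apply, Pi.add_apply, Pi.smul_apply, add_mul, Finset.sum_add_distrib]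
      simp only [Pi.single_apply, smul_eq_mul, mul_ite, mul_one, mul_zero, ite_mul, zero_mul,
        Finset.sum_ite_eq', Finset.mem_univ, if_true]
      linarith
    exact h3 ▸ neg_ne_zero.2 (mul_ne_zero h2 hμ)
  · exact ⟨p, hp, (mem_prolongDomain_iff hξ).2 ⟨hw, h0⟩⟩

end EvolClass

namespace EvolClass

/-! ### Derivatives of functions on the base space and of `ζ` -/

section Derivatives

variable {f : Base → ℝ} {w : Base}

lemma pd_add (f : Base → ℝ) (a b w : Base) : pd f (a + b) w = pd f a w + pd f b w := map_add _ _ _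

lemma pd_smul (f : Base → ℝ) (c : ℝ) (a w : Base) : pd f (c • a) w = c * pd f a w :=
  (fderiv ℝ f w).map_smul _ _

lemma tot_eq (f : Base → ℝ) (w : Base) (p : Fin 3 → ℝ) (μ : Fin 3) :
    tot f w p μ = pd f (ind μ) w + p μ * pd f dep w := by
  rw [tot, pd_add, pd_smul]

lemma pd2_expand (f : Base → ℝ) (a b c w : Base) (k l : ℝ) :
    pd2 f (a + k • c) (b + l • c) w =
      pd2 f a b w + l * pd2 f a c w + k * pd2 f c b w + k * l * pd2 f c c w := by
  simp only [pd2, map_add, map_smul, _root_.add_apply, _root_.smul_apply,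
    smul_eq_mul]
  ring

lemma pd2_comm (hf : ContDiffAt ℝ ∞ f w) (a b : Base) : pd2 f a b w = pd2 f b a w :=
  (hf.isSymmSndFDerivAt (by
    rw [minSmoothness_of_isRCLikeNormedField]
    exact WithTop.coe_le_coe.2 (le_top : (2 : ℕ∞) ≤ ⊤))) a b

lemma differentiableAt_fderiv (hf : ContDiffAt ℝ ∞ f w) : DifferentiableAt ℝ (fderiv ℝ f) w :=
  (hf.fderiv_right (m := ∞) (by simp)).differentiableAt (by simp)

lemma contDiffAt_pd (hf : ContDiffAt ℝ ∞ f w) (a : Base) : ContDiffAt ℝ ∞ (pd f a) w :=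
  (hf.fderiv_right (m := ∞) (by simp)).clm_apply contDiffAt_const

/-- A second derivative is the derivative of a first one. -/
lemma pd2_eq_pd (hf : ContDiffAt ℝ ∞ f w) (a b : Base) : pd2 f a b w = pd (pd f b) a w := by
  have h := (differentiableAt_fderiv hf).hasFDerivAt.clm_apply (hasFDerivAt_const b w)
  have h2 : fderiv ℝ (pd f b) w = _ := h.fderiv
  simp [pd, pd2, h2]

end Derivatives

section Zeta

variable {ξ : OpenPartialHomeomorph Base Base} {w : Base}

lemma IsSmooth.pd_zeta (hξ : IsSmooth ξ) (hw : w ∈ ξ.source) (q r : ℝ) (a : Base) :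
    pd (zeta ξ q r) a w = pd (depC ξ) a w - q * pd (indC ξ 1) a w - r * pd (indC ξ 2) a w := by
  have h1 := (hξ.contDiffAt_depC hw).differentiableAt (by simp)
  have h2 := (hξ.contDiffAt_indC hw 1).differentiableAt (by simp)
  have h3 := (hξ.contDiffAt_indC hw 2).differentiableAt (by simp)
  have h := ((h1.hasFDerivAt.sub (h2.hasFDerivAt.const_mul q)).sub
    (h3.hasFDerivAt.const_mul r)).fderiv
  have h' : fderiv ℝ (zeta ξ q r) w = _ := h
  simp [pd, h']

lemma IsSmooth.contDiffAt_zeta (hξ : IsSmooth ξ) (hw : w ∈ ξ.source) (q r : ℝ) :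
    ContDiffAt ℝ ∞ (zeta ξ q r) w :=
  ((hξ.contDiffAt_depC hw).sub (contDiffAt_const.mul (hξ.contDiffAt_indC hw 1))).sub
    (contDiffAt_const.mul (hξ.contDiffAt_indC hw 2))

lemma IsSmooth.pd2_zeta (hξ : IsSmooth ξ) (hw : w ∈ ξ.source) (q r : ℝ) (a b : Base) :
    pd2 (zeta ξ q r) a b w =
      pd2 (depC ξ) a b w - q * pd2 (indC ξ 1) a b w - r * pd2 (indC ξ 2) a b w := by
  have hU := hξ.contDiffAt_depC hw
  have hX := hξ.contDiffAt_indC hw 1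
  have hY := hξ.contDiffAt_indC hw 2
  rw [pd2_eq_pd (hξ.contDiffAt_zeta hw q r), pd2_eq_pd hU, pd2_eq_pd hX, pd2_eq_pd hY]
  have he : pd (zeta ξ q r) b =ᶠ[𝓝 w]
      fun w' => pd (depC ξ) b w' - q * pd (indC ξ 1) b w' - r * pd (indC ξ 2) b w' := by
    filter_upwards [ξ.open_source.mem_nhds hw] with w' hw'
    exact hξ.pd_zeta hw' q r b
  have h1 := (contDiffAt_pd hU b).differentiableAt (by simp)
  have h2 := (contDiffAt_pd hX b).differentiableAt (by simp)
  have h3 := (contDiffAt_pd hY b).differentiableAt (by simp)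
  have h := ((h1.hasFDerivAt.sub (h2.hasFDerivAt.const_mul q)).sub
    (h3.hasFDerivAt.const_mul r)).fderiv
  have h' : fderiv ℝ (pd (zeta ξ q r) b) w = _ := he.fderiv_eq.trans h
  rw [pd, h']
  simp [pd]

end Zeta

/-! ### Prolongation to second-order jets -/

section Prolong2

variable {ξ : OpenPartialHomeomorph Base Base} {j j' : Jet1}

open Matrix

/-- The matrix `(D_μ Xᵃ)` of total derivatives of the `(t, x, y)`-components, with rows `a`. -/
noncomputable def totMat (ξ : OpenPartialHomeomorph Base Base) (j : Jet1) :
    Matrix (Fin 3) (Fin 3) ℝ :=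
  Matrix.of fun a μ => tot (indC ξ a) j.1 j.2 μ

/-- The part of `D_μ D_ν U - ∑ u'_a D_μ D_ν Xᵃ` that is free of second derivatives of `u`. -/
noncomputable def hessMat (ξ : OpenPartialHomeomorph Base Base) (j j' : Jet1) :
    Matrix (Fin 3) (Fin 3) ℝ :=
  Matrix.of fun μ ν => pd2 (depC ξ) (ind μ + j.2 μ • dep) (ind ν + j.2 ν • dep) j.1 -
    ∑ a, j'.2 a * pd2 (indC ξ a) (ind μ + j.2 μ • dep) (ind ν + j.2 ν • dep) j.1

/-- The coefficient of `u_μν` in `D_μ D_ν U - ∑ u'_a D_μ D_ν Xᵃ`. -/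
noncomputable def depCoef (ξ : OpenPartialHomeomorph Base Base) (j j' : Jet1) : ℝ :=
  pd (depC ξ) dep j.1 - ∑ a, j'.2 a * pd (indC ξ a) dep j.1

/-- The transformation of the second derivatives in matrix form. -/
lemma prolong2_iff {s s' : Matrix (Fin 3) (Fin 3) ℝ} : Prolong2 ξ j s j' s' ↔
    Prolong1 ξ j j' ∧
      hessMat ξ j j' + depCoef ξ j j' • s = (totMat ξ j)ᵀ * s' * totMat ξ j := by
  refine and_congr_right fun _ => ?_
  rw [← Matrix.ext_iff]
  refine forall_congr' fun μ => forall_congr' fun ν => ?_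
  simp only [tot2, totMat, hessMat, depCoef, Matrix.mul_apply, Fin.sum_univ_three,
    Matrix.transpose_apply, Matrix.of_apply, Matrix.add_apply, Matrix.smul_apply, smul_eq_mul]
  constructor <;> intro h <;> linear_combination h

lemma hessMat_isSymm (hξ : IsSmooth ξ) (hj : j.1 ∈ ξ.source) : (hessMat ξ j j').IsSymm := by
  ext μ ν
  simp only [hessMat, Matrix.transpose_apply, Matrix.of_apply]
  rw [pd2_comm (hξ.contDiffAt_depC hj)]
  congr 1
  exact Finset.sum_congr rfl fun a _ => by rw [pd2_comm (hξ.contDiffAt_indC hj a)]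

lemma depCoef_eq (hξ : IsSmooth ξ) (hj : j.1 ∈ ξ.source) :
    depCoef ξ j j' = contactCov j'.2 (fderiv ℝ ξ j.1 dep) := by
  simp only [depCoef, contactCov_apply, hξ.pd_depC hj, hξ.pd_indC hj]

lemma depCoef_ne_zero (hξ : IsSmooth ξ) (h : Prolong1 ξ j j') : depCoef ξ j j' ≠ 0 := by
  rw [depCoef_eq hξ h.1]
  exact h.contactCov_fderiv_dep_ne hξ

/-- The total derivatives of the components of `ξ` and of its inverse form inverse matrices. -/
lemma totMat_mul_totMat_symm (hξ : IsSmooth ξ) (h : Prolong1 ξ j j') :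
    totMat ξ j * totMat ξ.symm j' = 1 := by
  have hs := h.symm hξ
  ext a b
  have hk := ((prolong1_iff_contactCov hξ.symm).1 hs).2.2 b
  have hd := base_decomp j.2 (fderiv ℝ ξ.symm j'.1 (ind b + j'.2 b • dep))
  rw [hk, zero_smul, add_zero] at hd
  have h2 : fderiv ℝ ξ j.1 (fderiv ℝ ξ.symm j'.1 (ind b + j'.2 b • dep)) = ind b + j'.2 b • dep := by
    rw [h.2.1]; exact hξ.fderiv_comp_symm h.1 _
  rw [hd, map_sum] at h2
  have h3 := congrFun (congrArg Prod.fst h2) a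
  simp only [Prod.fst_sum, Finset.sum_apply, (fderiv ℝ ξ j.1).map_smul, Prod.smul_fst,
    Pi.smul_apply, smul_eq_mul] at h3
  rw [Matrix.mul_apply]
  simp only [totMat, Matrix.of_apply, tot, hξ.pd_indC h.1, hξ.symm.pd_indC hs.1]
  simp only [mul_comm] at h3 ⊢
  rw [h3]
  simp [ind, dep, Matrix.one_apply, Pi.single_apply]

/-- Every symmetric matrix of second derivatives at the image jet comes from one at the source. -/
lemma Prolong1.exists_preimage (hξ : IsSmooth ξ) (h : Prolong1 ξ j j')
    {s' : Matrix (Fin 3) (Fin 3) ℝ} (hs' : s'.IsSymm) : ∃ s, s.IsSymm ∧ Prolong2 ξ j s j' s' := by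
  refine ⟨(depCoef ξ j j')⁻¹ • ((totMat ξ j)ᵀ * s' * totMat ξ j - hessMat ξ j j'), ?_,
    prolong2_iff.2 ⟨h, ?_⟩⟩
  · rw [Matrix.IsSymm, Matrix.transpose_smul, Matrix.transpose_sub, (hessMat_isSymm hξ h.1).eq,
      Matrix.transpose_mul, Matrix.transpose_mul, hs'.eq, Matrix.transpose_transpose,
      Matrix.mul_assoc]
  · rw [smul_inv_smul₀ (depCoef_ne_zero hξ h)]
    abel

/-- Every symmetric matrix of second derivatives has an image. -/
lemma Prolong1.exists_image (hξ : IsSmooth ξ) (h : Prolong1 ξ j j')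
    {s : Matrix (Fin 3) (Fin 3) ℝ} (hs : s.IsSymm) : ∃ s', s'.IsSymm ∧ Prolong2 ξ j s j' s' := by
  have hAB := totMat_mul_totMat_symm hξ h
  have hBA := mul_eq_one_comm.1 hAB
  set A := totMat ξ j
  set B := totMat ξ.symm j'
  set C := hessMat ξ j j' + depCoef ξ j j' • s with hC
  have hCs : Cᵀ = C := by
    rw [hC, Matrix.transpose_add, Matrix.transpose_smul, hs.eq, (hessMat_isSymm hξ h.1).eq]
  refine ⟨Bᵀ * C * B, ?_, prolong2_iff.2 ⟨h, ?_⟩⟩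
  · rw [Matrix.IsSymm, Matrix.transpose_mul, Matrix.transpose_mul, hCs, Matrix.transpose_transpose,
      Matrix.mul_assoc]
  · have h1 : Aᵀ * Bᵀ = 1 := by rw [← Matrix.transpose_mul, hBA, Matrix.transpose_one]
    calc C = (Aᵀ * Bᵀ) * C * (B * A) := by rw [h1, hBA, one_mul, mul_one]
      _ = Aᵀ * (Bᵀ * C * B) * A := by simp only [Matrix.mul_assoc]

/-- The equation `u_t = F u_xx + G u_yy + H u_xy + K` with the values `v = (F, G, H, K)` at a
second-order jet. -/
def SatisfiesAt (v : Fin 4 → ℝ) (j : Jet1) (s : Matrix (Fin 3) (Fin 3) ℝ) : Prop :=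
  j.2 0 = v 0 * s 1 1 + v 1 * s 2 2 + v 2 * s 1 2 + v 3

/-- The prolongation of `ξ` over `j ↦ j'` maps the equation with the values `v` of the arbitrary
elements to that with the values `v'`. -/
def MapsEqnAt (ξ : OpenPartialHomeomorph Base Base) (j j' : Jet1) (v v' : Fin 4 → ℝ) : Prop :=
  ∀ s s' : Matrix (Fin 3) (Fin 3) ℝ, s.IsSymm → s'.IsSymm → Prolong2 ξ j s j' s' →
    (SatisfiesAt v j s ↔ SatisfiesAt v' j' s')

/-- The condition `F G - H² / 4 ≠ 0`. -/
def Nondeg (v : Fin 4 → ℝ) : Prop := v 0 * v 1 - v 2 ^ 2 / 4 ≠ 0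

lemma mem_eqn_iff {θ : ArbElem} {s : Matrix (Fin 3) (Fin 3) ℝ} (hs : s.IsSymm) :
    (j, s) ∈ Eqn θ ↔ args j ∈ θ.dom ∧ SatisfiesAt (θ.toFun (args j)) j s :=
  and_iff_right hs

lemma Nondeg.ne_zero {v : Fin 4 → ℝ} (hv : Nondeg v) : 0 < v 0 ^ 2 + v 1 ^ 2 + v 2 ^ 2 := by
  by_contra! h
  have h0 : v 0 = 0 := by nlinarith [sq_nonneg (v 0), sq_nonneg (v 1), sq_nonneg (v 2)]
  have h2 : v 2 = 0 := by nlinarith [sq_nonneg (v 0), sq_nonneg (v 1), sq_nonneg (v 2)]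
  exact hv (by rw [h0, h2]; ring)

lemma Nondeg.exists_satisfiesAt {v : Fin 4 → ℝ} (hv : Nondeg v) (j : Jet1) :
    ∃ s : Matrix (Fin 3) (Fin 3) ℝ, s.IsSymm ∧ SatisfiesAt v j s := by
  have h := hv.ne_zero
  set k := (j.2 0 - v 3) / (v 0 ^ 2 + v 1 ^ 2 + v 2 ^ 2) with hk
  refine ⟨!![0, 0, 0; 0, k * v 0, k * v 2; 0, k * v 2, k * v 1], ?_, ?_⟩
  · ext a b; fin_cases a <;> fin_cases b <;> rfl
  · have : k * (v 0 ^ 2 + v 1 ^ 2 + v 2 ^ 2) = j.2 0 - v 3 := div_mul_cancel₀ _ h.ne'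
    simp [SatisfiesAt]
    linear_combination -this

/-- If the prolongation of `ξ` maps a nondegenerate equation to a nondegenerate one, then
`D_x T = D_y T = 0`: the second derivatives `u'_{t'a'}` do not enter the image equation, so that
the symbol of the original equation is degenerate in the direction of `(D_μ T)`. -/
lemma MapsEqnAt.tot_time_eq_zero (hξ : IsSmooth ξ) (h : Prolong1 ξ j j') {v v' : Fin 4 → ℝ}
    (hv : Nondeg v) (hv' : Nondeg v') (hm : MapsEqnAt ξ j j' v v') :
    tot (indC ξ 0) j.1 j.2 1 = 0 ∧ tot (indC ξ 0) j.1 j.2 2 = 0 := by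
  obtain ⟨s', hs', hsat⟩ := hv'.exists_satisfiesAt j'
  obtain ⟨s, hs, hp⟩ := h.exists_preimage hξ hs'
  have hsat0 := (hm s s' hs hs' hp).2 hsat
  set A := totMat ξ j with hA
  have hd := mul_eq_one_comm.1 (totMat_mul_totMat_symm hξ h)
  have key : ∀ b, A b 1 * (2 * v 0 * A 0 1 + v 2 * A 0 2) +
      A b 2 * (2 * v 1 * A 0 2 + v 2 * A 0 1) = 0 := by
    intro b
    -- A change of `s'` that leaves `s'_xx, s'_yy, s'_xy` as they are.
    set σ : Matrix (Fin 3) (Fin 3) ℝ := Matrix.single 0 b 1 + Matrix.single b 0 1 with hσ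
    have hσs : σᵀ = σ := by
      rw [hσ, Matrix.transpose_add, Matrix.transpose_single, Matrix.transpose_single, add_comm]
    have hs1' : (s' + σ).IsSymm := by rw [Matrix.IsSymm, Matrix.transpose_add, hs'.eq, hσs]
    obtain ⟨s1, hs1, hp1⟩ := h.exists_preimage hξ hs1'
    have hsat1 : SatisfiesAt v' j' (s' + σ) := by
      simpa [SatisfiesAt, hσ, Matrix.single_apply] using hsat
    have hsat1' := (hm _ _ hs1 hs1' hp1).2 hsat1
    have e0 := (prolong2_iff.1 hp).2
    have e1 := (prolong2_iff.1 hp1).2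
    have e2 : ∀ μ ν, depCoef ξ j j' * (s1 μ ν - s μ ν) = A 0 μ * A b ν + A b μ * A 0 ν := by
      intro μ ν
      have h0 := congrFun (congrFun e0 μ) ν
      have h1 := congrFun (congrFun e1 μ) ν
      have h3 : (Aᵀ * σ * A) μ ν = A 0 μ * A b ν + A b μ * A 0 ν := by
        rw [hσ, mul_add, add_mul, Matrix.add_apply]
        simp [Matrix.mul_apply, Matrix.single_apply, ite_and]
      rw [mul_add, add_mul] at h1
      simp only [Matrix.add_apply, Matrix.smul_apply, smul_eq_mul, ← hA, h3] at h0 h1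
      linear_combination h1 - h0
    have e3 : v 0 * (s1 1 1 - s 1 1) + v 1 * (s1 2 2 - s 2 2) + v 2 * (s1 1 2 - s 1 2) = 0 := by
      unfold SatisfiesAt at hsat0 hsat1'
      linear_combination hsat0 - hsat1'
    linear_combination depCoef ξ j j' * e3 - v 0 * e2 1 1 - v 1 * e2 2 2 - v 2 * e2 1 2
  set z : Fin 3 → ℝ := ![0, 2 * v 0 * A 0 1 + v 2 * A 0 2, 2 * v 1 * A 0 2 + v 2 * A 0 1] with hz
  have hAz : A *ᵥ z = 0 := by
    funext b
    simpa [hz, Matrix.mulVec, dotProduct, Fin.sum_univ_three] using key b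
  have hz0 : z = 0 := by
    have : totMat ξ.symm j' *ᵥ (A *ᵥ z) = z := by rw [Matrix.mulVec_mulVec, hd, Matrix.one_mulVec]
    rw [← this, hAz, Matrix.mulVec_zero]
  have h1 : 2 * v 0 * A 0 1 + v 2 * A 0 2 = 0 := by simpa [hz] using congrFun hz0 1
  have h2 : 2 * v 1 * A 0 2 + v 2 * A 0 1 = 0 := by simpa [hz] using congrFun hz0 2
  have h3 : A 0 1 * (v 0 * v 1 - v 2 ^ 2 / 4) = 0 := by
    linear_combination (v 1 / 2) * h1 - (v 2 / 4) * h2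
  have h4 : A 0 2 * (v 0 * v 1 - v 2 ^ 2 / 4) = 0 := by
    linear_combination (v 0 / 2) * h2 - (v 2 / 4) * h1
  exact ⟨(mul_eq_zero.1 h3).resolve_right hv, (mul_eq_zero.1 h4).resolve_right hv⟩

end Prolong2

end EvolClass

namespace EvolClass

/-! ### Point transformations with `T = T(t)` -/

variable {ξ : OpenPartialHomeomorph Base Base} {j j' : Jet1}

lemma HasBaseForm.pd_time (hB : HasBaseForm ξ) {w : Base} (hw : w ∈ ξ.source) {v : Base}
    (hv : v.1 0 = 0) : pd (indC ξ 0) v w = 0 := by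
  obtain ⟨τ, hτ⟩ := (hB.2 w hw).1
  have hd : DifferentiableAt ℝ (indC ξ 0) w :=
    (hB.1.contDiffAt_indC hw 0).differentiableAt (by simp)
  have hl : HasDerivAt (fun t : ℝ => indC ξ 0 (w + t • v)) (pd (indC ξ 0) v w) 0 :=
    hd.hasFDerivAt.hasLineDerivAt v
  have hc : Filter.Tendsto (fun t : ℝ => w + t • v) (𝓝 0) (𝓝 w) := by
    have : Continuous (fun t : ℝ => w + t • v) := by fun_prop
    simpa using this.tendsto 0
  have he : (fun t : ℝ => indC ξ 0 (w + t • v)) =ᶠ[𝓝 0] fun _ => τ (w.1 0) := by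
    filter_upwards [hc.eventually hτ] with t ht
    rw [ht]
    simp [hv]
  exact hl.unique ((hasDerivAt_const 0 _).congr_of_eventuallyEq he)

lemma dep_fst_zero : dep.1 0 = 0 := rfl

/-- If `T` is locally constant along `x, y, u`, then `ξ` has the required form: the inequation for
the Jacobian follows from the invertibility of the differential of `ξ`. -/
lemma hasBaseForm_of_pd_time (hξ : IsSmooth ξ)
    (h : ∀ w ∈ ξ.source, ∀ v : Base, v.1 0 = 0 → pd (indC ξ 0) v w = 0) : HasBaseForm ξ := by
  refine ⟨hξ, fun w hw => ⟨?_, mul_ne_zero ?_ ?_⟩⟩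
  · obtain ⟨ε, hε, hball⟩ := Metric.isOpen_iff.1 ξ.open_source w hw
    refine ⟨fun t => indC ξ 0 (Function.update w.1 0 t, w.2), ?_⟩
    filter_upwards [Metric.ball_mem_nhds w hε] with w' hw'
    set y : Base := (Function.update w.1 0 (w'.1 0), w.2) with hy
    have hyb : y ∈ Metric.ball w ε := by
      rw [Metric.mem_ball] at hw' ⊢
      refine lt_of_le_of_lt ?_ hw'
      rw [Prod.dist_eq, Prod.dist_eq]
      refine max_le ((dist_pi_le_iff (le_max_of_le_left dist_nonneg)).2 fun i => ?_) ?_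
      · by_cases hi : i = 0
        · subst hi
          simpa [hy] using Or.inl (dist_le_pi_dist w'.1 w.1 0)
        · simp [hy, hi]
      · simp [hy]
    obtain ⟨z, hz, hzeq⟩ := domain_mvt (f := indC ξ 0) (f' := fderiv ℝ (indC ξ 0))
      (s := Metric.ball w ε) (x := y) (y := w')
      (fun x hx => (((hξ.contDiffAt_indC (hball hx) 0).differentiableAt
        (by simp)).hasFDerivAt).hasFDerivWithinAt) (convex_ball w ε) hyb hw'
    have hzb := (convex_ball w ε).segment_subset hyb hw' hz
    have h0 := h z (hball hzb) (w' - y) (by simp [hy])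
    rw [pd] at h0
    rw [h0] at hzeq
    exact sub_eq_zero.1 hzeq
  -- If `T_t` vanished, `∂_t` would not be in the range of the differential.
  · intro h0
    set k := fderiv ℝ ξ.symm (ξ w) (ind 0)
    have hk : fderiv ℝ ξ w k = ind 0 := hξ.fderiv_comp_symm hw _
    have h1 : pd (indC ξ 0) k w = 1 := by rw [hξ.pd_indC hw, hk]; simp [ind]
    have hdec : k = k.1 0 • ind 0 + (k - k.1 0 • ind 0) := by abel
    rw [hdec, pd_add, pd_smul, h0, h w hw (k - k.1 0 • ind 0) (by simp [ind])] at h1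
    simp at h1
  -- A kernel vector of the Jacobian matrix would be one of the differential.
  · intro h0
    obtain ⟨c, hc, hc0⟩ := Matrix.exists_mulVec_eq_zero_iff.2 h0
    set k : Base := c 0 • ind 1 + c 1 • ind 2 + c 2 • dep with hk
    have e0 : pd (indC ξ 0) k w = 0 := h w hw k (by simp [hk, ind, dep])
    have hexp : ∀ f : Base → ℝ, pd f k w =
        pd f (ind 1) w * c 0 + pd f (ind 2) w * c 1 + pd f dep w * c 2 := fun f => by
      rw [hk, pd_add, pd_add, pd_smul, pd_smul, pd_smul]; ring
    have e1 : pd (indC ξ 1) k w = 0 := by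
      rw [hexp]; simpa [Matrix.mulVec, dotProduct, Fin.sum_univ_three] using congrFun hc0 0
    have e2 : pd (indC ξ 2) k w = 0 := by
      rw [hexp]; simpa [Matrix.mulVec, dotProduct, Fin.sum_univ_three] using congrFun hc0 1
    have e3 : pd (depC ξ) k w = 0 := by
      rw [hexp]; simpa [Matrix.mulVec, dotProduct, Fin.sum_univ_three] using congrFun hc0 2
    rw [hξ.pd_indC hw] at e0 e1 e2
    rw [hξ.pd_depC hw] at e3
    have hz : fderiv ℝ ξ w k = 0 := by
      refine Prod.ext (funext fun a => ?_) e3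
      fin_cases a
      exacts [e0, e1, e2]
    have hk0 : k = 0 := by rw [← hξ.fderiv_symm_comp hw k, hz, map_zero]
    apply hc
    funext a
    fin_cases a
    · simpa [hk, ind, dep] using congrFun (congrArg Prod.fst hk0) 1
    · simpa [hk, ind, dep] using congrFun (congrArg Prod.fst hk0) 2
    · simpa [hk, ind, dep] using congrArg Prod.snd hk0

/-- If, over each point of the domain of `ξ`, `D_x T = D_y T = 0` at the prolongable jets of a nonempty
open set, then `T = T(t)` locally. -/
lemma hasBaseForm_of_tot_time (hξ : IsSmooth ξ)
    (h : ∀ w ∈ ξ.source, ∃ O : Set (Fin 3 → ℝ), IsOpen O ∧ O.Nonempty ∧ ∀ p ∈ O,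
      (w, p) ∈ prolongDomain ξ →
        tot (indC ξ 0) w p 1 = 0 ∧ tot (indC ξ 0) w p 2 = 0) : HasBaseForm ξ := by
  refine hasBaseForm_of_pd_time hξ fun w hw v hv => ?_
  obtain ⟨O, hO, hne, hO'⟩ := h w hw
  obtain ⟨p, hpO, hp⟩ := exists_mem_prolongDomain hξ hw hO hne
  have hopen : IsOpen (O ∩ {p | (w, p) ∈ prolongDomain ξ}) :=
    hO.inter ((isOpen_prolongDomain hξ).preimage (by fun_prop : Continuous fun p => (w, p)))
  have hc : Filter.Tendsto (fun ε : ℝ => p + ε • (Pi.single 1 1 : Fin 3 → ℝ)) (𝓝[≠] 0) (𝓝 p) := by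
    have : Continuous (fun ε : ℝ => p + ε • (Pi.single 1 1 : Fin 3 → ℝ)) := by fun_prop
    simpa using (this.tendsto 0).mono_left nhdsWithin_le_nhds
  obtain ⟨ε, ⟨h1, h2⟩, hε⟩ :=
    ((hc.eventually (hopen.mem_nhds ⟨hpO, hp⟩)).and self_mem_nhdsWithin).exists
  have hx := (hO' p hpO hp).1
  have hy := (hO' p hpO hp).2
  have hx' := (hO' _ h1 h2).1
  rw [tot_eq] at hx hy hx'
  have hu : pd (indC ξ 0) dep w = 0 := by
    have : ε * pd (indC ξ 0) dep w = 0 := by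
      simp only [Pi.add_apply, Pi.smul_apply, Pi.single_eq_same, smul_eq_mul, mul_one] at hx'
      linear_combination hx' - hx
    exact (mul_eq_zero.1 this).resolve_left hε
  rw [hu, mul_zero, add_zero] at hx hy
  have hdec : v = v.1 1 • ind 1 + v.1 2 • ind 2 + v.2 • dep := by
    refine Prod.ext (funext fun a => ?_) ?_
    · fin_cases a <;> simp [ind, dep, hv]
    · simp [ind, dep]
  rw [hdec, pd_add, pd_add, pd_smul, pd_smul, pd_smul, hx, hy, hu]
  ring

lemma HasBaseForm.pd2_time (hB : HasBaseForm ξ) {w : Base} (hw : w ∈ ξ.source) (a : Base) {v : Base}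
    (hv : v.1 0 = 0) : pd2 (indC ξ 0) a v w = 0 := by
  rw [pd2_eq_pd (hB.1.contDiffAt_indC hw 0)]
  have he : pd (indC ξ 0) v =ᶠ[𝓝 w] fun _ => 0 := by
    filter_upwards [ξ.open_source.mem_nhds hw] with w' hw'
    exact hB.pd_time hw' hv
  rw [pd, he.fderiv_eq]
  simp

lemma HasBaseForm.tot_time (hB : HasBaseForm ξ) {w : Base} (hw : w ∈ ξ.source) (p : Fin 3 → ℝ)
    {μ : Fin 3} (hμ : μ ≠ 0) : tot (indC ξ 0) w p μ = 0 :=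
  hB.pd_time hw (by simp [ind, dep, hμ.symm])

lemma HasBaseForm.tot_time_zero (hB : HasBaseForm ξ) {w : Base} (hw : w ∈ ξ.source)
    (p : Fin 3 → ℝ) : tot (indC ξ 0) w p 0 = pd (indC ξ 0) (ind 0) w := by
  rw [tot_eq, hB.pd_time hw dep_fst_zero, mul_zero, add_zero]

lemma HasBaseForm.pd_time_ne_zero (hB : HasBaseForm ξ) {w : Base} (hw : w ∈ ξ.source) :
    pd (indC ξ 0) (ind 0) w ≠ 0 :=
  left_ne_zero_of_mul (hB.2 w hw).2

lemma HasBaseForm.depCoef_eq_zeta (hB : HasBaseForm ξ) (hj : j.1 ∈ ξ.source) :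
    depCoef ξ j j' = pd (zeta ξ (j'.2 1) (j'.2 2)) dep j.1 := by
  rw [hB.1.pd_zeta hj, depCoef, Fin.sum_univ_three, hB.pd_time hj dep_fst_zero]
  ring

/-- The chain rule for the spatial derivatives, in terms of `ζ`. -/
lemma HasBaseForm.zeta_spatial (hB : HasBaseForm ξ) (h : Prolong1 ξ j j') {μ : Fin 3} (hμ : μ ≠ 0) :
    pd (zeta ξ (j'.2 1) (j'.2 2)) (ind μ) j.1 = -(j.2 μ * depCoef ξ j j') := by
  have := h.2.2 μ
  rw [Fin.sum_univ_three, hB.tot_time h.1 _ hμ, tot_eq, tot_eq, tot_eq] at this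
  rw [hB.depCoef_eq_zeta h.1, hB.1.pd_zeta h.1, hB.1.pd_zeta h.1]
  linear_combination this

/-- The chain rule for the time derivative, in terms of `ζ`. -/
lemma HasBaseForm.zeta_time (hB : HasBaseForm ξ) (h : Prolong1 ξ j j') :
    pd (zeta ξ (j'.2 1) (j'.2 2)) (ind 0) j.1 =
      j'.2 0 * pd (indC ξ 0) (ind 0) j.1 - j.2 0 * depCoef ξ j j' := by
  have := h.2.2 0
  rw [Fin.sum_univ_three, hB.tot_time_zero h.1, tot_eq, tot_eq, tot_eq] at this
  rw [hB.depCoef_eq_zeta h.1, hB.1.pd_zeta h.1, hB.1.pd_zeta h.1]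
  linear_combination this

lemma HasBaseForm.hessMat_eq_zeta (hB : HasBaseForm ξ) (hj : j.1 ∈ ξ.source) {μ ν : Fin 3}
    (hν : ν ≠ 0) : hessMat ξ j j' μ ν =
      pd2 (zeta ξ (j'.2 1) (j'.2 2)) (ind μ + j.2 μ • dep) (ind ν + j.2 ν • dep) j.1 := by
  rw [hB.1.pd2_zeta hj, hessMat, Matrix.of_apply, Fin.sum_univ_three,
    hB.pd2_time hj _ (by simp [ind, dep, hν.symm])]
  ring

/-- The determinant of the spatial total derivatives does not vanish: its product with `ζ_u` is the
Jacobian `∂(X, Y, U)/∂(x, y, u)`. -/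
lemma HasBaseForm.spatial_det_ne_zero (hB : HasBaseForm ξ) (h : Prolong1 ξ j j') :
    tot (indC ξ 1) j.1 j.2 1 * tot (indC ξ 2) j.1 j.2 2 -
      tot (indC ξ 1) j.1 j.2 2 * tot (indC ξ 2) j.1 j.2 1 ≠ 0 := by
  intro h0
  apply right_ne_zero_of_mul (hB.2 j.1 h.1).2
  have h1 := h.2.2 1
  have h2 := h.2.2 2
  rw [Fin.sum_univ_three, hB.tot_time h.1 _ (by decide)] at h1 h2
  simp only [tot_eq] at h0 h1 h2
  rw [Matrix.det_fin_three]
  simp only [Matrix.of_apply, Matrix.cons_val', Matrix.cons_val_zero, Matrix.cons_val_one,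
    Matrix.cons_val_fin_one, Matrix.cons_val]
  generalize pd (indC ξ 1) (ind 1) j.1 = Xx at *
  generalize pd (indC ξ 1) (ind 2) j.1 = Xy at *
  generalize pd (indC ξ 1) dep j.1 = Xu at *
  generalize pd (indC ξ 2) (ind 1) j.1 = Yx at *
  generalize pd (indC ξ 2) (ind 2) j.1 = Yy at *
  generalize pd (indC ξ 2) dep j.1 = Yu at *
  generalize pd (depC ξ) (ind 1) j.1 = Ux at *
  generalize pd (depC ξ) (ind 2) j.1 = Uy at *
  generalize pd (depC ξ) dep j.1 = Uu at *
  linear_combination (Uu - j'.2 1 * Xu - j'.2 2 * Yu) * h0 +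
    (Xy * Yu - Xu * Yy) * h1 + (Xu * Yx - Xx * Yu) * h2

/-! ### The transformation of the arbitrary elements -/

/-- The affine transformation of the values `(F, G, H, K)` with coefficients
`c = (D_x X, D_y X, D_x Y, D_y Y, T_t, ζ_u, k_xx, k_yy, k_xy, ζ_t)`, where `k_μν` is the part of
`D_μ D_ν ζ` that is free of second derivatives of `u`. -/
noncomputable def affElem (c : Fin 10 → ℝ) (v : Fin 4 → ℝ) : Fin 4 → ℝ :=
  ![(c 0 ^ 2 * v 0 + c 1 ^ 2 * v 1 + c 0 * c 1 * v 2) / c 4,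
    (c 2 ^ 2 * v 0 + c 3 ^ 2 * v 1 + c 2 * c 3 * v 2) / c 4,
    (2 * c 0 * c 2 * v 0 + 2 * c 1 * c 3 * v 1 + (c 0 * c 3 + c 1 * c 2) * v 2) / c 4,
    (c 5 * v 3 - c 6 * v 0 - c 7 * v 1 - c 8 * v 2 + c 9) / c 4]

/-- The inverse of `affElem`; its first three components are the action of the adjugate of the
`2 × 2` matrix of spatial total derivatives. -/
noncomputable def affElemInv (c : Fin 10 → ℝ) (v : Fin 4 → ℝ) : Fin 4 → ℝ :=
  let δ := c 0 * c 3 - c 1 * c 2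
  let F := c 4 * (c 3 ^ 2 * v 0 + c 1 ^ 2 * v 1 - c 1 * c 3 * v 2) / δ ^ 2
  let G := c 4 * (c 2 ^ 2 * v 0 + c 0 ^ 2 * v 1 - c 0 * c 2 * v 2) / δ ^ 2
  let H := c 4 * (-(2 * c 2 * c 3 * v 0) - 2 * c 0 * c 1 * v 1 + (c 0 * c 3 + c 1 * c 2) * v 2) /
    δ ^ 2
  ![F, G, H, (c 4 * v 3 + c 6 * F + c 7 * G + c 8 * H - c 9) / c 5]

/-- The coefficients for which `affElem` is invertible. -/
def regCoefs : Set (Fin 10 → ℝ) := {c | c 0 * c 3 - c 1 * c 2 ≠ 0 ∧ c 4 ≠ 0 ∧ c 5 ≠ 0}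

lemma affElemInv_affElem {c : Fin 10 → ℝ} (hc : c ∈ regCoefs) (v : Fin 4 → ℝ) :
    affElemInv c (affElem c v) = v := by
  obtain ⟨hd, h4, h5⟩ := hc
  have e0 : affElemInv c (affElem c v) 0 = v 0 := by
    simp only [affElem, affElemInv, Matrix.cons_val_zero, Matrix.cons_val_one, Matrix.cons_val]
    generalize hδ : c 0 * c 3 - c 1 * c 2 = δ at *
    field_simp
    rw [← hδ]
    ring
  have e1 : affElemInv c (affElem c v) 1 = v 1 := by
    simp only [affElem, affElemInv, Matrix.cons_val_zero, Matrix.cons_val_one, Matrix.cons_val]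
    generalize hδ : c 0 * c 3 - c 1 * c 2 = δ at *
    field_simp
    rw [← hδ]
    ring
  have e2 : affElemInv c (affElem c v) 2 = v 2 := by
    simp only [affElem, affElemInv, Matrix.cons_val_zero, Matrix.cons_val_one, Matrix.cons_val]
    generalize hδ : c 0 * c 3 - c 1 * c 2 = δ at *
    field_simp
    rw [← hδ]
    ring
  have e3 : affElemInv c (affElem c v) 3 = (c 4 * affElem c v 3 +
      c 6 * affElemInv c (affElem c v) 0 + c 7 * affElemInv c (affElem c v) 1 +
      c 8 * affElemInv c (affElem c v) 2 - c 9) / c 5 := rfl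
  rw [e0, e1, e2] at e3
  funext a
  fin_cases a
  · exact e0
  · exact e1
  · exact e2
  · refine e3.trans ?_
    simp [affElem]
    field_simp
    ring

lemma affElem_affElemInv {c : Fin 10 → ℝ} (hc : c ∈ regCoefs) (v : Fin 4 → ℝ) :
    affElem c (affElemInv c v) = v := by
  obtain ⟨hd, h4, h5⟩ := hc
  funext a
  fin_cases a
  · simp [affElem, affElemInv]
    generalize hδ : c 0 * c 3 - c 1 * c 2 = δ at *
    field_simp
    rw [← hδ]
    ring
  · simp [affElem, affElemInv]
    generalize hδ : c 0 * c 3 - c 1 * c 2 = δ at *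
    field_simp
    rw [← hδ]
    ring
  · simp [affElem, affElemInv]
    generalize hδ : c 0 * c 3 - c 1 * c 2 = δ at *
    field_simp
    rw [← hδ]
    ring
  · have : (c 5 * affElemInv c v 3) = c 4 * v 3 + c 6 * affElemInv c v 0 + c 7 * affElemInv c v 1 +
      c 8 * affElemInv c v 2 - c 9 := mul_div_cancel₀ _ h5
    change (c 5 * affElemInv c v 3 - c 6 * affElemInv c v 0 - c 7 * affElemInv c v 1 -
      c 8 * affElemInv c v 2 + c 9) / c 4 = v 3
    rw [this]
    field_simp
    ring

lemma nondeg_affElem {c : Fin 10 → ℝ} (hc : c ∈ regCoefs) {v : Fin 4 → ℝ} (hv : Nondeg v) :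
    Nondeg (affElem c v) := by
  obtain ⟨hd, h4, h5⟩ := hc
  have : affElem c v 0 * affElem c v 1 - affElem c v 2 ^ 2 / 4 =
      (c 0 * c 3 - c 1 * c 2) ^ 2 / c 4 ^ 2 * (v 0 * v 1 - v 2 ^ 2 / 4) := by
    simp [affElem]
    field_simp
    ring
  rw [Nondeg, this]
  exact mul_ne_zero (div_ne_zero (pow_ne_zero _ hd) (pow_ne_zero _ h4)) hv

/-- The coefficients of the transformation of the arbitrary elements at the jet `j`. The last one,
`ζ_t`, is expressed by the chain rule. -/
noncomputable def coefs (ξ : OpenPartialHomeomorph Base Base) (j : Jet1) : Fin 10 → ℝ :=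
  ![tot (indC ξ 1) j.1 j.2 1, tot (indC ξ 1) j.1 j.2 2, tot (indC ξ 2) j.1 j.2 1,
    tot (indC ξ 2) j.1 j.2 2, pd (indC ξ 0) (ind 0) j.1, depCoef ξ j (prolongMap ξ j),
    hessMat ξ j (prolongMap ξ j) 1 1, hessMat ξ j (prolongMap ξ j) 2 2,
    hessMat ξ j (prolongMap ξ j) 1 2,
    (prolongMap ξ j).2 0 * pd (indC ξ 0) (ind 0) j.1 - j.2 0 * depCoef ξ j (prolongMap ξ j)]

lemma HasBaseForm.coefs_mem (hB : HasBaseForm ξ) (hj : j ∈ prolongDomain ξ) :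
    coefs ξ j ∈ regCoefs := by
  have h := prolong1_prolongMap hB.1 hj
  exact ⟨hB.spatial_det_ne_zero h, hB.pd_time_ne_zero h.1, depCoef_ne_zero hB.1 h⟩

lemma HasBaseForm.elemTransform_eq (hB : HasBaseForm ξ) (h : Prolong1 ξ j j') (v : Fin 4 → ℝ) :
    elemTransform ξ j.1 (j'.2 1) (j'.2 2) v = affElem (coefs ξ j) v := by
  have hκ := depCoef_ne_zero hB.1 h
  have hT := hB.pd_time_ne_zero h.1
  have hzx := hB.zeta_spatial h (μ := 1) (by decide)
  have hzy := hB.zeta_spatial h (μ := 2) (by decide)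
  have hzt := hB.zeta_time h
  have hzu := hB.depCoef_eq_zeta (j' := j') h.1
  have hc := fun a b => pd2_comm (hB.1.contDiffAt_zeta h.1 (j'.2 1) (j'.2 2)) a b
  have hxx := hB.hessMat_eq_zeta (j' := j') h.1 (μ := 1) (ν := 1) (by decide)
  have hyy := hB.hessMat_eq_zeta (j' := j') h.1 (μ := 2) (ν := 2) (by decide)
  have hxy := hB.hessMat_eq_zeta (j' := j') h.1 (μ := 1) (ν := 2) (by decide)
  rw [pd2_expand] at hxx hyy hxy
  rw [hc dep (ind 1)] at hxx
  rw [hc dep (ind 2)] at hyy hxy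
  unfold elemTransform coefs
  rw [← h.eq_prolongMap hB.1, ← hzt]
  simp only [hzx, hzy, ← hzu, hxx, hyy, hxy, tot_eq, affElem]
  generalize depCoef ξ j j' = κ at *
  generalize pd (indC ξ 0) (ind 0) j.1 = τ at *
  funext a
  fin_cases a
  · simp
    field_simp
  · simp
    field_simp
  · simp
    field_simp
  · simp
    field_simp
    ring

/-- The identity behind the transformation formulas: the defects of the original and of the
transformed equation are proportional, with the factor `ζ_u / T_t`. -/
lemma HasBaseForm.defect_eq (hB : HasBaseForm ξ) {s s' : Matrix (Fin 3) (Fin 3) ℝ}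
    (hs' : s'.IsSymm) (h : Prolong2 ξ j s j' s') (v : Fin 4 → ℝ) :
    let v' := affElem (coefs ξ j) v
    pd (indC ξ 0) (ind 0) j.1 *
        (j'.2 0 - (v' 0 * s' 1 1 + v' 1 * s' 2 2 + v' 2 * s' 1 2 + v' 3)) =
      depCoef ξ j j' * (j.2 0 - (v 0 * s 1 1 + v 1 * s 2 2 + v 2 * s 1 2 + v 3)) := by
  intro v'
  have hT := hB.pd_time_ne_zero h.1.1
  have he := (prolong2_iff.1 h).2
  have h01 : totMat ξ j 0 1 = 0 := hB.tot_time h.1.1 _ (by decide)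
  have h02 : totMat ξ j 0 2 = 0 := hB.tot_time h.1.1 _ (by decide)
  have h21 : s' 2 1 = s' 1 2 := hs'.apply 1 2
  have e11 := congrFun (congrFun he 1) 1
  have e22 := congrFun (congrFun he 2) 2
  have e12 := congrFun (congrFun he 1) 2
  simp only [Matrix.mul_apply, Fin.sum_univ_three, Matrix.transpose_apply, Matrix.add_apply,
    Matrix.smul_apply, smul_eq_mul, h01, h02, h21] at e11 e22 e12
  have hv' : v' = affElem (coefs ξ j) v := rfl
  unfold coefs at hv'
  rw [← h.1.eq_prolongMap hB.1] at hv'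
  have t11 : totMat ξ j 1 1 = tot (indC ξ 1) j.1 j.2 1 := rfl
  have t12 : totMat ξ j 1 2 = tot (indC ξ 1) j.1 j.2 2 := rfl
  have t21 : totMat ξ j 2 1 = tot (indC ξ 2) j.1 j.2 1 := rfl
  have t22 : totMat ξ j 2 2 = tot (indC ξ 2) j.1 j.2 2 := rfl
  rw [t11, t21] at e11
  rw [t12, t22] at e22
  rw [t11, t12, t21, t22] at e12
  have m0 := congrFun hv' 0
  have m1 := congrFun hv' 1
  have m2 := congrFun hv' 2
  have m3 := congrFun hv' 3
  simp only [affElem, Matrix.cons_val_zero, Matrix.cons_val_one, Matrix.cons_val,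
    eq_div_iff hT] at m0 m1 m2 m3
  linear_combination v 0 * e11 + v 1 * e22 + v 2 * e12 - s' 1 1 * m0 - s' 2 2 * m1 - s' 1 2 * m2 - m3

lemma HasBaseForm.mapsEqnAt (hB : HasBaseForm ξ) (h : Prolong1 ξ j j') (v : Fin 4 → ℝ) :
    MapsEqnAt ξ j j' v (affElem (coefs ξ j) v) := by
  intro s s' _ hs' hp
  have hd := hB.defect_eq hs' hp v
  have hT := hB.pd_time_ne_zero h.1
  have hκ := depCoef_ne_zero hB.1 h
  simp only [SatisfiesAt, ← sub_eq_zero (a := j.2 0), ← sub_eq_zero (a := j'.2 0)]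
  constructor
  · intro h0
    rw [h0, mul_zero] at hd
    exact (mul_eq_zero.1 hd).resolve_left hT
  · intro h0
    simp only [h0, mul_zero] at hd
    exact (mul_eq_zero.1 hd.symm).resolve_left hκ

/-- The jet `j` with the value of `u_t` replaced. -/
def setTime (j : Jet1) (c : ℝ) : Jet1 := (j.1, Function.update j.2 0 c)

lemma args_setTime (j : Jet1) (c : ℝ) : args (setTime j c) = args j := by
  simp [args, setTime]

lemma setTime_time (j : Jet1) (c : ℝ) : (setTime j c).2 0 = c := by
  simp [setTime]

lemma eq_setTime_of_args_eq {i j : Jet1} (h : args i = args j) : i = setTime j (i.2 0) := by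
  simp only [args, Prod.mk.injEq] at h
  refine Prod.ext h.1 (funext fun a => ?_)
  fin_cases a <;> simp [setTime, h.2.1, h.2.2]

/-- A change of `u_t` alone changes `u'_{t'}` alone. -/
lemma HasBaseForm.prolong1_setTime (hB : HasBaseForm ξ) (h : Prolong1 ξ j j') (c : ℝ) :
    Prolong1 ξ (setTime j c) (setTime j'
      (j'.2 0 + (c - j.2 0) * depCoef ξ j j' / pd (indC ξ 0) (ind 0) j.1)) := by
  refine ⟨h.1, h.2.1, fun μ => ?_⟩
  have hT := hB.pd_time_ne_zero h.1
  have hμ := h.2.2 μ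
  rw [Fin.sum_univ_three] at hμ ⊢
  by_cases h0 : μ = 0
  · subst h0
    rw [hB.tot_time_zero h.1] at hμ
    have ht : tot (indC ξ 0) (setTime j c).1 (setTime j c).2 0 = pd (indC ξ 0) (ind 0) j.1 :=
      hB.tot_time_zero h.1 _
    rw [ht]
    simp only [tot_eq] at hμ ⊢
    simp [setTime]
    rw [hB.depCoef_eq_zeta h.1, hB.1.pd_zeta h.1]
    field_simp
    linear_combination hμ
  · rw [hB.tot_time h.1 _ h0] at hμ
    have ht : tot (indC ξ 0) (setTime j c).1 (setTime j c).2 μ = 0 := hB.tot_time h.1 _ h0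
    rw [ht]
    simp only [tot_eq] at hμ ⊢
    simpa [setTime, h0] using hμ

/-- Conversely, a change of `u'_{t'}` alone stems from a change of `u_t` alone. -/
lemma HasBaseForm.exists_setTime (hB : HasBaseForm ξ) (h : Prolong1 ξ j j') (c' : ℝ) :
    ∃ c, Prolong1 ξ (setTime j c) (setTime j' c') := by
  have hT := hB.pd_time_ne_zero h.1
  have hκ := depCoef_ne_zero hB.1 h
  refine ⟨j.2 0 + (c' - j'.2 0) * pd (indC ξ 0) (ind 0) j.1 / depCoef ξ j j', ?_⟩
  convert hB.prolong1_setTime h _ using 2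
  field_simp
  ring

/-- The transformation of the arbitrary elements does not depend on `u_t`. -/
lemma HasBaseForm.affElem_coefs_setTime (hB : HasBaseForm ξ) (h : Prolong1 ξ j j') {c c' : ℝ}
    (h2 : Prolong1 ξ (setTime j c) (setTime j' c')) (v : Fin 4 → ℝ) :
    affElem (coefs ξ (setTime j c)) v = affElem (coefs ξ j) v := by
  rw [← hB.elemTransform_eq h2, ← hB.elemTransform_eq h]
  simp [setTime]

/-- An affine function that is bound to a given nonconstant one on two of its level sets equals
it. -/
lemma eq_of_level_sets {v v' : Fin 4 → ℝ} (hv : 0 < v 0 ^ 2 + v 1 ^ 2 + v 2 ^ 2) {c₁ c₂ : ℝ}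
    (hc : c₁ ≠ c₂)
    (h₁ : ∀ a b d, c₁ = v 0 * a + v 1 * b + v 2 * d + v 3 → c₁ = v' 0 * a + v' 1 * b + v' 2 * d + v' 3)
    (h₂ : ∀ a b d, c₂ = v 0 * a + v 1 * b + v 2 * d + v 3 → c₂ = v' 0 * a + v' 1 * b + v' 2 * d + v' 3) :
    v' = v := by
  have key : ∀ a b d, v' 0 * a + v' 1 * b + v' 2 * d + v' 3 = v 0 * a + v 1 * b + v 2 * d + v 3 := by
    intro a b d
    set n := v 0 ^ 2 + v 1 ^ 2 + v 2 ^ 2 with hn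
    set L := v 0 * a + v 1 * b + v 2 * d + v 3 with hL
    -- The points where the gradient line through `(a, b, d)` meets the level sets.
    have g : ∀ c, ((c - L) / n) * n = c - L := fun c => div_mul_cancel₀ _ hv.ne'
    have g₁ := h₁ (a + (c₁ - L) / n * v 0) (b + (c₁ - L) / n * v 1) (d + (c₁ - L) / n * v 2)
      (by linear_combination -g c₁)
    have g₂ := h₂ (a + (c₂ - L) / n * v 0) (b + (c₂ - L) / n * v 1) (d + (c₂ - L) / n * v 2)
      (by linear_combination -g c₂)
    set m := v' 0 * v 0 + v' 1 * v 1 + v' 2 * v 2 with hm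
    have hmn : (c₁ - c₂) * (m - n) = 0 := by
      have e : c₁ - c₂ = ((c₁ - L) / n - (c₂ - L) / n) * m := by linear_combination g₁ - g₂
      have e2 : ((c₁ - L) / n - (c₂ - L) / n) * n = c₁ - c₂ := by linear_combination g c₁ - g c₂
      linear_combination -m * e2 - n * e
    have hmn' : m = n := sub_eq_zero.1 ((mul_eq_zero.1 hmn).resolve_left (sub_ne_zero.2 hc))
    linear_combination -g₁ - g c₁ - (c₁ - L) / n * hmn'
  have k0 := key 0 0 0
  have k1 := key 1 0 0
  have k2 := key 0 1 0
  have k3 := key 0 0 1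
  funext i
  fin_cases i <;> simp only [Fin.zero_eta, Fin.mk_one, Fin.reduceFinMk] <;> linarith

/-- The values of the arbitrary elements of the image equation are determined by the
transformation of the equation over two jets that differ in `u_t` only. -/
lemma HasBaseForm.eq_affElem (hB : HasBaseForm ξ) (h : Prolong1 ξ j j') {v v' : Fin 4 → ℝ}
    (hv : Nondeg v) {c c' : ℝ} (hc : c ≠ j.2 0) (h2 : Prolong1 ξ (setTime j c) (setTime j' c'))
    (hm : MapsEqnAt ξ j j' v v') (hm2 : MapsEqnAt ξ (setTime j c) (setTime j' c') v v') :
    v' = affElem (coefs ξ j) v := by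
  have hj : j ∈ prolongDomain ξ := ⟨_, h⟩
  have hT := hB.pd_time_ne_zero h.1
  have hκ := depCoef_ne_zero hB.1 h
  have hcc : j'.2 0 ≠ c' := by
    have e := (h2.eq_prolongMap hB.1).trans ((hB.prolong1_setTime h c).eq_prolongMap hB.1).symm
    have e0 := congrFun (congrArg Prod.snd e) 0
    rw [setTime_time, setTime_time] at e0
    intro hh
    rw [← hh] at e0
    have : (c - j.2 0) * depCoef ξ j j' / pd (indC ξ 0) (ind 0) j.1 = 0 := by linarith
    simp [hT, hκ, sub_eq_zero, hc] at this
  have hsame := hB.affElem_coefs_setTime h h2 v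
  have step : ∀ {i i' : Jet1}, Prolong1 ξ i i' → MapsEqnAt ξ i i' v v' →
      affElem (coefs ξ i) v = affElem (coefs ξ j) v → ∀ a b d,
      i'.2 0 = affElem (coefs ξ j) v 0 * a + affElem (coefs ξ j) v 1 * b +
        affElem (coefs ξ j) v 2 * d + affElem (coefs ξ j) v 3 →
      i'.2 0 = v' 0 * a + v' 1 * b + v' 2 * d + v' 3 := by
    intro i i' hi hmi he a b d hsat
    have hs' : (!![0, 0, 0; 0, a, d; 0, d, b] : Matrix (Fin 3) (Fin 3) ℝ).IsSymm := by
      ext k l; fin_cases k <;> fin_cases l <;> rfl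
    obtain ⟨s, hs, hp⟩ := hi.exists_preimage hB.1 hs'
    have h1 := (hB.mapsEqnAt hi v s _ hs hs' hp).2 (by rw [he]; simpa [SatisfiesAt] using hsat)
    simpa [SatisfiesAt] using (hmi s _ hs hs' hp).1 h1
  refine eq_of_level_sets (nondeg_affElem (hB.coefs_mem hj) hv).ne_zero hcc (step h hm rfl) ?_
  simpa only [setTime_time] using step h2 hm2 hsame

end EvolClass

namespace EvolClass

/-! ### Smoothness of the induced transformations -/

section Smoothness

variable {ξ : OpenPartialHomeomorph Base Base}

lemma contDiffOn_pd_jet (hξ : IsSmooth ξ) {f : Base → ℝ} (hf : ContDiffOn ℝ ∞ f ξ.source)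
    {a : Jet1 → Base} (ha : ContDiff ℝ ∞ a) :
    ContDiffOn ℝ ∞ (fun j => pd f (a j) j.1) (prolongDomain ξ) :=
  ((hf.fderiv_of_isOpen (m := ∞) ξ.open_source (by simp)).comp contDiff_fst.contDiffOn
    fun _ hj => ((mem_prolongDomain_iff hξ).1 hj).1).clm_apply ha.contDiffOn

lemma contDiffOn_pd2_jet (hξ : IsSmooth ξ) {f : Base → ℝ} (hf : ContDiffOn ℝ ∞ f ξ.source)
    {a b : Jet1 → Base} (ha : ContDiff ℝ ∞ a) (hb : ContDiff ℝ ∞ b) :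
    ContDiffOn ℝ ∞ (fun j => pd2 f (a j) (b j) j.1) (prolongDomain ξ) :=
  ((((hf.fderiv_of_isOpen (m := ∞) ξ.open_source (by simp)).fderiv_of_isOpen (m := ∞)
    ξ.open_source (by simp)).comp contDiff_fst.contDiffOn
    fun _ hj => ((mem_prolongDomain_iff hξ).1 hj).1).clm_apply ha.contDiffOn).clm_apply
    hb.contDiffOn

lemma contDiffOn_coefs (hξ : IsSmooth ξ) : ContDiffOn ℝ ∞ (coefs ξ) (prolongDomain ξ) := by
  have hX : ∀ a, ContDiffOn ℝ ∞ (indC ξ a) ξ.source := fun a w hw =>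
    (hξ.contDiffAt_indC hw a).contDiffWithinAt
  have hU : ContDiffOn ℝ ∞ (depC ξ) ξ.source := fun w hw =>
    (hξ.contDiffAt_depC hw).contDiffWithinAt
  have he : ∀ μ, ContDiff ℝ ∞ fun j : Jet1 => ind μ + j.2 μ • dep := fun μ =>
    contDiff_const.add (((contDiff_apply ℝ ℝ μ).comp contDiff_snd).smul contDiff_const)
  have hp : ∀ a, ContDiffOn ℝ ∞ (fun j => (prolongMap ξ j).2 a) (prolongDomain ξ) := fun a =>
    contDiffOn_pi.1 (contDiffOn_prolongMap hξ).snd a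
  have htot : ∀ a μ, ContDiffOn ℝ ∞ (fun j : Jet1 => tot (indC ξ a) j.1 j.2 μ)
      (prolongDomain ξ) := fun a μ => contDiffOn_pd_jet hξ (hX a) (he μ)
  have hκ : ContDiffOn ℝ ∞ (fun j => depCoef ξ j (prolongMap ξ j)) (prolongDomain ξ) :=
    (contDiffOn_pd_jet hξ hU contDiff_const).sub (ContDiffOn.sum fun a _ =>
      (hp a).mul (contDiffOn_pd_jet hξ (hX a) contDiff_const))
  have hhess : ∀ μ ν, ContDiffOn ℝ ∞ (fun j => hessMat ξ j (prolongMap ξ j) μ ν)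
      (prolongDomain ξ) := fun μ ν =>
    (contDiffOn_pd2_jet hξ hU (he μ) (he ν)).sub (ContDiffOn.sum fun a _ =>
      (hp a).mul (contDiffOn_pd2_jet hξ (hX a) (he μ) (he ν)))
  have hT := contDiffOn_pd_jet hξ (hX 0) (a := fun _ => ind 0) contDiff_const
  have h0 : ContDiffOn ℝ ∞ (fun j : Jet1 => j.2 0) (prolongDomain ξ) :=
    ((contDiff_apply ℝ ℝ 0).comp contDiff_snd).contDiffOn
  refine contDiffOn_pi.2 fun i => ?_
  fin_cases i
  exacts [htot 1 1, htot 1 2, htot 2 1, htot 2 2, hT, hκ, hhess 1 1, hhess 2 2, hhess 1 2,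
    ((hp 0).mul hT).sub (h0.mul hκ)]

lemma contDiffOn_affElem : ContDiffOn ℝ ∞
    (fun z : (Fin 10 → ℝ) × (Fin 4 → ℝ) => affElem z.1 z.2) (regCoefs ×ˢ Set.univ) := by
  refine contDiffOn_pi.2 fun i => ?_
  fin_cases i <;>
    exact ContDiffOn.div (ContDiff.contDiffOn (by fun_prop)) (ContDiff.contDiffOn (by fun_prop))
      fun z hz => hz.1.2.1

lemma contDiffOn_affElemInv : ContDiffOn ℝ ∞
    (fun z : (Fin 10 → ℝ) × (Fin 4 → ℝ) => affElemInv z.1 z.2) (regCoefs ×ˢ Set.univ) := by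
  have hδ : ContDiffOn ℝ ∞ (fun z : (Fin 10 → ℝ) × (Fin 4 → ℝ) =>
      (z.1 0 * z.1 3 - z.1 1 * z.1 2) ^ 2) (regCoefs ×ˢ Set.univ) :=
    ContDiff.contDiffOn (by fun_prop)
  have hδ0 : ∀ z ∈ (regCoefs ×ˢ Set.univ : Set ((Fin 10 → ℝ) × (Fin 4 → ℝ))),
      (z.1 0 * z.1 3 - z.1 1 * z.1 2) ^ 2 ≠ 0 := fun z hz => pow_ne_zero 2 hz.1.1
  have h0 : ContDiffOn ℝ ∞ (fun z : (Fin 10 → ℝ) × (Fin 4 → ℝ) => affElemInv z.1 z.2 0)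
      (regCoefs ×ˢ Set.univ) := ContDiffOn.div (ContDiff.contDiffOn (by fun_prop)) hδ hδ0
  have h1 : ContDiffOn ℝ ∞ (fun z : (Fin 10 → ℝ) × (Fin 4 → ℝ) => affElemInv z.1 z.2 1)
      (regCoefs ×ˢ Set.univ) := ContDiffOn.div (ContDiff.contDiffOn (by fun_prop)) hδ hδ0
  have h2 : ContDiffOn ℝ ∞ (fun z : (Fin 10 → ℝ) × (Fin 4 → ℝ) => affElemInv z.1 z.2 2)
      (regCoefs ×ˢ Set.univ) := ContDiffOn.div (ContDiff.contDiffOn (by fun_prop)) hδ hδ0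
  have hc : ∀ i, ContDiffOn ℝ ∞ (fun z : (Fin 10 → ℝ) × (Fin 4 → ℝ) => z.1 i)
      (regCoefs ×ˢ Set.univ) := fun i => ContDiff.contDiffOn (by fun_prop)
  have hv : ContDiffOn ℝ ∞ (fun z : (Fin 10 → ℝ) × (Fin 4 → ℝ) => z.2 3)
      (regCoefs ×ˢ Set.univ) := ContDiff.contDiffOn (by fun_prop)
  refine contDiffOn_pi.2 fun i => ?_
  fin_cases i
  · exact h0
  · exact h1
  · exact h2
  · exact ((((((hc 4).mul hv).add ((hc 6).mul h0)).add ((hc 7).mul h1)).add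
      ((hc 8).mul h2)).sub (hc 9)).div (hc 5) fun z hz => hz.1.2.2

lemma contDiffOn_affElem_comp {E : Type*} [NormedAddCommGroup E] [NormedSpace ℝ E] {s : Set E}
    {c : E → Fin 10 → ℝ} {v : E → Fin 4 → ℝ} (hc : ContDiffOn ℝ ∞ c s) (hv : ContDiffOn ℝ ∞ v s)
    (hm : ∀ x ∈ s, c x ∈ regCoefs) : ContDiffOn ℝ ∞ (fun x => affElem (c x) (v x)) s := by
  have h : ContDiffOn ℝ ∞ (fun x => (c x, v x)) s := hc.prodMk hv
  have hmaps : Set.MapsTo (fun x => (c x, v x)) s (regCoefs ×ˢ Set.univ) :=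
    fun x hx => ⟨hm x hx, trivial⟩
  exact ContDiffOn.comp contDiffOn_affElem h hmaps

lemma contDiffOn_affElemInv_comp {E : Type*} [NormedAddCommGroup E] [NormedSpace ℝ E] {s : Set E}
    {c : E → Fin 10 → ℝ} {v : E → Fin 4 → ℝ} (hc : ContDiffOn ℝ ∞ c s) (hv : ContDiffOn ℝ ∞ v s)
    (hm : ∀ x ∈ s, c x ∈ regCoefs) : ContDiffOn ℝ ∞ (fun x => affElemInv (c x) (v x)) s := by
  have h : ContDiffOn ℝ ∞ (fun x => (c x, v x)) s := hc.prodMk hv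
  have hmaps : Set.MapsTo (fun x => (c x, v x)) s (regCoefs ×ˢ Set.univ) :=
    fun x hx => ⟨hm x hx, trivial⟩
  exact ContDiffOn.comp contDiffOn_affElemInv h hmaps

lemma HasBaseForm.contDiffOn_equivTransform (hB : HasBaseForm ξ) :
    ContDiffOn ℝ ∞ (fun z : Ext => (prolongMap ξ z.1, affElem (coefs ξ z.1) z.2))
      (prolongDomain ξ ×ˢ Set.univ) := by
  have hm : Set.MapsTo (Prod.fst : Ext → Jet1) (prolongDomain ξ ×ˢ Set.univ) (prolongDomain ξ) :=
    fun z hz => hz.1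
  refine ContDiffOn.prodMk ((contDiffOn_prolongMap hB.1).comp contDiffOn_fst hm) ?_
  exact contDiffOn_affElem_comp ((contDiffOn_coefs hB.1).comp contDiffOn_fst hm) contDiffOn_snd
    fun z hz => hB.coefs_mem hz.1

lemma HasBaseForm.contDiffOn_equivTransform_symm (hB : HasBaseForm ξ) :
    ContDiffOn ℝ ∞ (fun z : Ext => (prolongMap ξ.symm z.1,
      affElemInv (coefs ξ (prolongMap ξ.symm z.1)) z.2))
      (prolongDomain ξ.symm ×ˢ Set.univ) := by
  have hm : Set.MapsTo (Prod.fst : Ext → Jet1) (prolongDomain ξ.symm ×ˢ Set.univ)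
      (prolongDomain ξ.symm) := fun z hz => hz.1
  have h := (contDiffOn_prolongMap hB.1.symm).comp contDiffOn_fst hm
  have hm2 : Set.MapsTo (prolongMap ξ.symm ∘ (Prod.fst : Ext → Jet1))
      (prolongDomain ξ.symm ×ˢ Set.univ) (prolongDomain ξ) :=
    fun z hz => (prolong ξ hB.1).map_target hz.1
  exact h.prodMk (contDiffOn_affElemInv_comp ((contDiffOn_coefs hB.1).comp h hm2) contDiffOn_snd
    fun z hz => hB.coefs_mem (hm2 hz))

end Smoothness

variable {ξ : OpenPartialHomeomorph Base Base} {j j' : Jet1}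

/-! ### The induced equivalence transformation -/

/-- The equivalence transformation induced by a point transformation `ξ` of the required form, on
its largest domain. -/
noncomputable def equivTransform (ξ : OpenPartialHomeomorph Base Base) (hB : HasBaseForm ξ) :
    OpenPartialHomeomorph Ext Ext where
  toFun z := (prolongMap ξ z.1, affElem (coefs ξ z.1) z.2)
  invFun z := (prolongMap ξ.symm z.1, affElemInv (coefs ξ (prolongMap ξ.symm z.1)) z.2)
  source := prolongDomain ξ ×ˢ Set.univ
  target := prolongDomain ξ.symm ×ˢ Set.univ
  map_source' z hz := ⟨(prolong ξ hB.1).map_source hz.1, trivial⟩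
  map_target' z hz := ⟨(prolong ξ hB.1).map_target hz.1, trivial⟩
  left_inv' z hz := by
    have h : prolongMap ξ.symm (prolongMap ξ z.1) = z.1 := (prolong ξ hB.1).left_inv hz.1
    simp only [h, affElemInv_affElem (hB.coefs_mem hz.1)]
  right_inv' z hz := by
    have h : prolongMap ξ (prolongMap ξ.symm z.1) = z.1 := (prolong ξ hB.1).right_inv hz.1
    have hm : prolongMap ξ.symm z.1 ∈ prolongDomain ξ := (prolong ξ hB.1).map_target hz.1
    simp only [h, affElem_affElemInv (hB.coefs_mem hm)]
  open_source := (isOpen_prolongDomain hB.1).prod isOpen_univ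
  open_target := (isOpen_prolongDomain hB.1.symm).prod isOpen_univ
  continuousOn_toFun := hB.contDiffOn_equivTransform.continuousOn
  continuousOn_invFun := hB.contDiffOn_equivTransform_symm.continuousOn

lemma isSmooth_equivTransform (hB : HasBaseForm ξ) : IsSmooth (equivTransform ξ hB) :=
  ⟨hB.contDiffOn_equivTransform, hB.contDiffOn_equivTransform_symm⟩

lemma restrictsTo_equivTransform (hB : HasBaseForm ξ) : RestrictsTo (equivTransform ξ hB) ξ := by
  refine ⟨?_, fun z hz => rfl⟩
  ext w
  constructor
  · intro hw
    obtain ⟨p, -, hp⟩ := exists_mem_prolongDomain hB.1 hw isOpen_univ Set.univ_nonempty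
    exact ⟨((w, p), 0), ⟨hp, trivial⟩, rfl⟩
  · rintro ⟨z, hz, rfl⟩
    exact ((mem_prolongDomain_iff hB.1).1 hz.1).1

lemma hasEquivalenceForm_equivTransform (hB : HasBaseForm ξ) :
    HasEquivalenceForm (equivTransform ξ hB) := by
  refine ⟨isSmooth_equivTransform hB, ξ, hB, restrictsTo_equivTransform hB, fun z hz => ?_⟩
  have h := prolong1_prolongMap hB.1 hz.1
  exact ⟨h, (hB.elemTransform_eq h z.2).symm⟩

/-- The jet over given values of `(t, x, y, u, u_x, u_y)` with `u_t = 0`. -/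
def zeroTimeJet (z : Args) : Jet1 := (z.1, ![0, z.2.1, z.2.2])

lemma zeroTimeJet_args (j : Jet1) : zeroTimeJet (args j) = setTime j 0 :=
  eq_setTime_of_args_eq (i := zeroTimeJet (args j)) rfl

lemma contDiff_zeroTimeJet : ContDiff ℝ ∞ zeroTimeJet := by
  refine contDiff_fst.prodMk (contDiff_pi.2 fun i => ?_)
  fin_cases i
  exacts [contDiff_const, contDiff_snd.fst, contDiff_snd.snd]

lemma contDiff_args : ContDiff ℝ ∞ args :=
  contDiff_fst.prodMk (((contDiff_apply ℝ ℝ 1).comp contDiff_snd).prodMk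
    ((contDiff_apply ℝ ℝ 2).comp contDiff_snd))

/-- The image of a tuple `θ` of arbitrary elements under the equivalence transformation induced by
`ξ`. As neither `(u'_{x'}, u'_{y'})` nor the transformed values depend on `u_t`, they are computed
at the preimages of the jets with `u'_{t'} = 0`. -/
noncomputable def pushforward (ξ : OpenPartialHomeomorph Base Base) (hB : HasBaseForm ξ)
    (θ : ArbElem) : ArbElem where
  dom := zeroTimeJet ⁻¹' (prolongDomain ξ.symm ∩ (fun j => args (prolongMap ξ.symm j)) ⁻¹' θ.dom)
  isOpen_dom := by
    refine IsOpen.preimage contDiff_zeroTimeJet.continuous ?_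
    exact (contDiff_args.continuous.comp_continuousOn
      (contDiffOn_prolongMap hB.1.symm).continuousOn).isOpen_inter_preimage
      (isOpen_prolongDomain hB.1.symm) θ.isOpen_dom
  toFun z := affElem (coefs ξ (prolongMap ξ.symm (zeroTimeJet z)))
    (θ.toFun (args (prolongMap ξ.symm (zeroTimeJet z))))
  smooth := by
    have h : ContDiffOn ℝ ∞ (fun z => prolongMap ξ.symm (zeroTimeJet z)) (zeroTimeJet ⁻¹'
        (prolongDomain ξ.symm ∩ (fun j => args (prolongMap ξ.symm j)) ⁻¹' θ.dom)) :=
      (contDiffOn_prolongMap hB.1.symm).comp contDiff_zeroTimeJet.contDiffOn fun z hz => hz.1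
    have hm : ∀ z ∈ zeroTimeJet ⁻¹' (prolongDomain ξ.symm ∩
        (fun j => args (prolongMap ξ.symm j)) ⁻¹' θ.dom),
        prolongMap ξ.symm (zeroTimeJet z) ∈ prolongDomain ξ := fun z hz =>
      (prolong ξ hB.1).map_target hz.1
    exact contDiffOn_affElem_comp ((contDiffOn_coefs hB.1).comp h hm)
      (θ.smooth.comp (contDiff_args.comp_contDiffOn h) fun z hz => hz.2)
      fun z hz => hB.coefs_mem (hm z hz)
  nondeg z hz := nondeg_affElem (hB.coefs_mem ((prolong ξ hB.1).map_target hz.1))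
    (θ.nondeg _ hz.2)

lemma args_mem_pushforward_dom (hB : HasBaseForm ξ) {θ : ArbElem} (h : Prolong1 ξ j j') :
    args j' ∈ (pushforward ξ hB θ).dom ↔ args j ∈ θ.dom := by
  obtain ⟨c, hc⟩ := hB.exists_setTime h 0
  have hs := hc.symm hB.1
  have he : prolongMap ξ.symm (zeroTimeJet (args j')) = setTime j c := by
    rw [zeroTimeJet_args, ← hs.eq_prolongMap hB.1.symm]
  change zeroTimeJet (args j') ∈ _ ∧ args (prolongMap ξ.symm (zeroTimeJet (args j'))) ∈ θ.dom ↔ _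
  rw [he, args_setTime]
  refine and_iff_right ?_
  rw [zeroTimeJet_args]
  exact ⟨_, hs⟩

lemma pushforward_toFun (hB : HasBaseForm ξ) (θ : ArbElem) (h : Prolong1 ξ j j') :
    (pushforward ξ hB θ).toFun (args j') = affElem (coefs ξ j) (θ.toFun (args j)) := by
  obtain ⟨c, hc⟩ := hB.exists_setTime h 0
  have he : prolongMap ξ.symm (zeroTimeJet (args j')) = setTime j c := by
    rw [zeroTimeJet_args, ← (hc.symm hB.1).eq_prolongMap hB.1.symm]
  change affElem (coefs ξ (prolongMap ξ.symm (zeroTimeJet (args j'))))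
    (θ.toFun (args (prolongMap ξ.symm (zeroTimeJet (args j'))))) = _
  rw [he, args_setTime, hB.affElem_coefs_setTime h hc]

/-- The contact transformation required by the definition of the equivalence group is the restriction
of `prolong ξ` to the projection of the domain of `Ξ`. -/
theorem HasEquivalenceForm.mem_equivalenceGroup {Ξ : OpenPartialHomeomorph Ext Ext}
    (hΞ : HasEquivalenceForm Ξ) : Ξ ∈ equivalenceGroup := by
  obtain ⟨hs, ξ, hB, hR, hf⟩ := hΞ
  have hξ := hB.1
  have hO : IsOpen (Prod.fst '' Ξ.source) := isOpenMap_fst _ Ξ.open_source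
  have hsub : Prod.fst '' Ξ.source ⊆ prolongDomain ξ := by
    rintro _ ⟨z, hz, rfl⟩
    exact ⟨_, (hf z hz).1⟩
  have hsrc : ((prolong ξ hξ).restrOpen _ hO).source = Prod.fst '' Ξ.source := by
    rw [OpenPartialHomeomorph.restrOpen_source]
    exact Set.inter_eq_right.2 hsub
  have hΞe : ∀ z ∈ Ξ.source, (Ξ z).2 = affElem (coefs ξ z.1) z.2 := fun z hz => by
    rw [(hf z hz).2, hB.elemTransform_eq (hf z hz).1]
  refine ⟨hs, (prolong ξ hξ).restrOpen _ hO, ξ, ⟨?_, hsrc, fun z hz => ?_⟩,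
    ⟨hξ, ?_, fun j _ => rfl⟩, ?_, ?_⟩
  · refine ⟨(contDiffOn_prolongMap hξ).mono (hsrc.subset.trans hsub),
      (contDiffOn_prolongMap hξ.symm).mono fun j hj => ?_⟩
    exact hj.1
  · exact ((hf z hz).1.eq_prolongMap hξ).symm
  · rw [hsrc, hR.1, Set.image_image]
  · intro j hj η hη
    rw [hsrc] at hj
    have hp := prolong1_prolongMap hξ (hsub hj)
    have hd := ((isSmooth_prolong hξ).differentiableAt (hsub hj)).hasFDerivAt
    have h1 : HasFDerivAt (fun i : Jet1 => ξ i.1) ((ContinuousLinearMap.fst ℝ _ _).comp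
        (fderiv ℝ (prolong ξ hξ) j)) j := hd.fst
    have h2 : HasFDerivAt (fun i : Jet1 => ξ i.1) ((fderiv ℝ ξ j.1).comp
        (ContinuousLinearMap.fst ℝ _ _)) j :=
      ((hξ.differentiableAt hp.1).hasFDerivAt).comp j hasFDerivAt_fst
    have h3 : (fderiv ℝ (prolong ξ hξ) j η).1 = fderiv ℝ ξ j.1 η.1 :=
      DFunLike.congr_fun (h1.unique h2) η
    rw [contactForm_eq] at hη
    change contactForm (prolongMap ξ j) (fderiv ℝ (prolong ξ hξ) j η) = 0
    rw [contactForm_eq, h3, hp.contactCov_fderiv hξ, hη, mul_zero]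
  · intro θ
    refine ⟨pushforward ξ hB θ, ?_, ?_⟩
    · apply Set.Subset.antisymm
      · rintro _ ⟨z, ⟨⟨hz1, hz2⟩, hz⟩, rfl⟩
        refine ⟨⟨(args_mem_pushforward_dom hB (hf z hz).1).2 hz1, ?_⟩, Ξ.map_source hz⟩
        rw [pushforward_toFun hB θ (hf z hz).1, hΞe z hz, hz2]
      · rintro z' ⟨⟨hz1, hz2⟩, hz'⟩
        have hz := Ξ.map_target hz'
        have hi := Ξ.right_inv hz'
        set z := Ξ.symm z'
        have hp := (hf z hz).1
        rw [← hi, pushforward_toFun hB θ hp, hΞe z hz] at hz2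
        rw [← hi, args_mem_pushforward_dom hB hp] at hz1
        refine ⟨z, ⟨⟨hz1, ?_⟩, hz⟩, hi⟩
        have hreg := hB.coefs_mem ⟨_, hp⟩
        rw [← affElemInv_affElem hreg z.2, hz2, affElemInv_affElem hreg]
    · intro j s j' s' hj hs hs' hp
      rw [mem_eqn_iff hs, mem_eqn_iff hs', args_mem_pushforward_dom hB hp.1,
        pushforward_toFun hB θ hp.1]
      exact and_congr_right fun _ => hB.mapsEqnAt hp.1 _ s s' hs hs' hp

end EvolClass

namespace EvolClass

/-! ### Elements of the equivalence group and of the equivalence groupoid -/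

variable {ξ : OpenPartialHomeomorph Base Base}

lemma dense_nondeg : Dense {v : Fin 4 → ℝ | Nondeg v} := by
  rw [dense_iff_inter_open]
  rintro V hV ⟨v, hv⟩
  by_cases h : Nondeg v
  · exact ⟨v, hv, h⟩
  have h0 : v 0 * v 1 - v 2 ^ 2 / 4 = 0 := not_not.1 h
  -- Moving `F` and `G` by `ε` changes `F G - H² / 4` by `ε (ε + F + G)`; the sign of `ε` is
  -- chosen so that the second factor does not vanish either.
  set e : Fin 4 → ℝ := ![1, 1, 0, 0] with he
  have hc : Continuous (fun ε : ℝ => v + ε • e) := by fun_prop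
  have ht : Filter.Tendsto (fun ε : ℝ => v + ε • e) (𝓝 0) (𝓝 v) := by simpa using hc.tendsto 0
  have hev := ht.eventually (hV.mem_nhds hv)
  have key : ∀ ε : ℝ, ε ≠ 0 → ε + (v 0 + v 1) ≠ 0 → Nondeg (v + ε • e) := by
    intro ε h1 h2
    have : (v + ε • e) 0 * (v + ε • e) 1 - (v + ε • e) 2 ^ 2 / 4 = ε * (ε + (v 0 + v 1)) := by
      simp [he]
      linear_combination h0
    rw [Nondeg, this]
    exact mul_ne_zero h1 h2
  rcases le_total 0 (v 0 + v 1) with hs | hs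
  · obtain ⟨ε, h1, h2⟩ := ((hev.filter_mono nhdsWithin_le_nhds).and
      (self_mem_nhdsWithin (s := Set.Ioi (0 : ℝ)))).exists
    exact ⟨_, h1, key ε (ne_of_gt h2) (add_pos_of_pos_of_nonneg h2 hs).ne'⟩
  · obtain ⟨ε, h1, h2⟩ := ((hev.filter_mono nhdsWithin_le_nhds).and
      (self_mem_nhdsWithin (s := Set.Iio (0 : ℝ)))).exists
    exact ⟨_, h1, key ε (ne_of_lt h2) (add_neg_of_neg_of_nonpos h2 hs).ne⟩

lemma continuous_setTime (j : Jet1) : Continuous (setTime j) :=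
  continuous_const.prodMk (continuous_const.update 0 continuous_id)

lemma setTime_self (j : Jet1) : setTime j (j.2 0) = j := by
  simp [setTime]

/-- The tuple of constant arbitrary elements with given nondegenerate values. -/
def constElem (v : Fin 4 → ℝ) (hv : Nondeg v) : ArbElem where
  dom := Set.univ
  isOpen_dom := isOpen_univ
  toFun _ := v
  smooth := contDiffOn_const
  nondeg _ _ := hv

/-- Preservation of the contact structure forces the derivatives of `u` to transform by the chain
rule. -/
lemma IsContact.prolong1 {φ : OpenPartialHomeomorph Jet1 Jet1} (hc : IsContact φ)
    (hφ : IsSmooth φ) (hP : ProjectsTo φ ξ) {j : Jet1} (hj : j ∈ φ.source) :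
    Prolong1 ξ j (φ j) := by
  obtain ⟨hξ, hsrc, hval⟩ := hP
  have hw : j.1 ∈ ξ.source := by rw [hsrc]; exact ⟨j, hj, rfl⟩
  have hd := (hφ.differentiableAt hj).hasFDerivAt
  have h1 : HasFDerivAt (fun i : Jet1 => (φ i).1) ((ContinuousLinearMap.fst ℝ _ _).comp
      (fderiv ℝ φ j)) j := hd.fst
  have h2 : HasFDerivAt (fun i : Jet1 => ξ i.1) ((fderiv ℝ ξ j.1).comp
      (ContinuousLinearMap.fst ℝ _ _)) j :=
    ((hξ.differentiableAt hw).hasFDerivAt).comp j hasFDerivAt_fst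
  have h2' := h2.congr_of_eventuallyEq (f₁ := fun i : Jet1 => (φ i).1) (by
    filter_upwards [φ.open_source.mem_nhds hj] with i hi
    exact (hval i hi).symm)
  refine (prolong1_iff_contactCov hξ).2 ⟨hw, (hval j hj).symm, fun μ => ?_⟩
  have h3 : (fderiv ℝ φ j (ind μ + j.2 μ • dep, 0)).1 = fderiv ℝ ξ j.1 (ind μ + j.2 μ • dep) :=
    DFunLike.congr_fun (h1.unique h2') (ind μ + j.2 μ • dep, 0)
  have h4 := hc j hj (ind μ + j.2 μ • dep, 0) (by rw [contactForm_eq, contactCov_tangent])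
  rwa [contactForm_eq, h3] at h4

/-- All values of `Ξ` at points with the same nondegenerate `v = (F, G, H, K)` come from one tuple of
arbitrary elements, the image of the constant tuple `v`. -/
lemma PreservesClass.exists_image {Ξ : OpenPartialHomeomorph Ext Ext} (h : PreservesClass Ξ ξ)
    {v : Fin 4 → ℝ} (hv : Nondeg v) : ∃ θ' : ArbElem, ∀ j, (j, v) ∈ Ξ.source →
      args (Ξ (j, v)).1 ∈ θ'.dom ∧ (Ξ (j, v)).2 = θ'.toFun (args (Ξ (j, v)).1) ∧
      MapsEqnAt ξ j (Ξ (j, v)).1 v (Ξ (j, v)).2 := by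
  obtain ⟨θ', himg, heqn⟩ := h (constElem v hv)
  refine ⟨θ', fun j hj => ?_⟩
  have hg : (j, v) ∈ graph (constElem v hv) := ⟨trivial, rfl⟩
  have hg' : Ξ (j, v) ∈ graph θ' ∩ Ξ.target := himg ▸ Set.mem_image_of_mem Ξ ⟨hg, hj⟩
  refine ⟨hg'.1.1, hg'.1.2, fun s s' hs hs' hp2 => ?_⟩
  have := heqn j s _ s' ⟨hg, hj⟩ hs hs' hp2
  rw [mem_eqn_iff hs, mem_eqn_iff hs', and_iff_right (show args j ∈ (constElem v hv).dom from
    trivial), and_iff_right hg'.1.1, ← hg'.1.2] at this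
  exact this

theorem hasEquivalenceForm_of_mem_equivalenceGroup {Ξ : OpenPartialHomeomorph Ext Ext}
    (hΞ : Ξ ∈ equivalenceGroup) : HasEquivalenceForm Ξ := by
  obtain ⟨hs, φ, ξ, ⟨hφ, hφsrc, hφval⟩, hP, hc, hpc⟩ := hΞ
  have hξ := hP.1
  have hp : ∀ z ∈ Ξ.source, Prolong1 ξ z.1 (Ξ z).1 := fun z hz => by
    rw [← hφval z hz]
    exact hc.prolong1 hφ hP (by rw [hφsrc]; exact ⟨z, hz, rfl⟩)
  have hR : RestrictsTo Ξ ξ := by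
    refine ⟨by rw [hP.2.1, hφsrc, Set.image_image], fun z hz => ?_⟩
    exact (hp z hz).2.1.symm
  have hfib : ∀ j, IsOpen {v | (j, v) ∈ Ξ.source} := fun j =>
    Ξ.open_source.preimage (Continuous.prodMk_right j)
  have hB : HasBaseForm ξ := by
    refine hasBaseForm_of_tot_time hξ fun w hw => ?_
    rw [hR.1] at hw
    obtain ⟨⟨j, v₀⟩, hz, rfl⟩ := hw
    obtain ⟨v, hvs, hv⟩ := dense_nondeg.inter_open_nonempty _ (hfib j) ⟨v₀, hz⟩
    obtain ⟨θ', hθ'⟩ := hpc.exists_image hv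
    refine ⟨{p | ((j.1, p), v) ∈ Ξ.source}, Ξ.open_source.preimage (by fun_prop), ⟨j.2, hvs⟩,
      fun p hpO _ => ?_⟩
    obtain ⟨h1, h2, h3⟩ := hθ' _ hpO
    exact h3.tot_time_eq_zero hξ (hp _ hpO) hv (by rw [h2]; exact θ'.nondeg _ h1)
  have hform : ∀ j v, (j, v) ∈ Ξ.source → Nondeg v →
      (Ξ (j, v)).2 = affElem (coefs ξ j) v := by
    intro j v hz hv
    obtain ⟨θ', hθ'⟩ := hpc.exists_image hv
    have hcont : Filter.Tendsto (fun c => ((setTime j c, v) : Ext)) (𝓝[≠] (j.2 0)) (𝓝 (j, v)) := by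
      have h := ((continuous_setTime j).prodMk (continuous_const (y := v))).tendsto (j.2 0)
      rw [setTime_self] at h
      exact h.mono_left nhdsWithin_le_nhds
    obtain ⟨c, hcs, hcne⟩ := ((hcont.eventually (Ξ.open_source.mem_nhds hz)).and
      self_mem_nhdsWithin).exists
    have hj := hp _ hz
    have hc1 := hp _ hcs
    have he := (hc1.eq_prolongMap hξ).trans ((hB.prolong1_setTime hj c).eq_prolongMap hξ).symm
    obtain ⟨h1, h2, h3⟩ := hθ' _ hz
    obtain ⟨k1, k2, k3⟩ := hθ' _ hcs
    have hval : (Ξ (setTime j c, v)).2 = (Ξ (j, v)).2 := by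
      rw [k2, h2, he, args_setTime]
    rw [hval] at k3
    simp only [he] at hc1 k3
    exact hB.eq_affElem hj hv hcne hc1 h3 k3
  refine ⟨hs, ξ, hB, hR, fun z hz => ⟨hp z hz, ?_⟩⟩
  rw [hB.elemTransform_eq (hp z hz)]
  -- The formula extends to degenerate values by continuity.
  obtain ⟨j, v⟩ := z
  have hcl := dense_nondeg.open_subset_closure_inter (hfib j)
  refine Set.EqOn.of_subset_closure (f := fun v => (Ξ (j, v)).2) (g := affElem (coefs ξ j))
    (s := {v | (j, v) ∈ Ξ.source} ∩ {v | Nondeg v}) (t := {v | (j, v) ∈ Ξ.source})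
    (fun v hv => hform j v hv.1 hv.2) ?_ ?_ Set.inter_subset_left hcl hz
  · exact continuous_snd.comp_continuousOn
      (Ξ.continuousOn.comp (Continuous.prodMk_right j).continuousOn fun v hv => hv)
  · exact (contDiffOn_affElem_comp contDiffOn_const contDiffOn_id
      fun v _ => hB.coefs_mem ⟨_, hp _ hz⟩).continuousOn

/-- A triple of the equivalence groupoid determines `ξ` as of the required form and the values of `θ'`
as those given by the formulas, so that `equivTransform ξ` induces the triple. -/
theorem isNormalized : IsNormalized := by
  intro θ ξ θ' ⟨hξ, hdom, heqn⟩
  have hstep : ∀ {j j'}, Prolong1 ξ j j' → args j ∈ θ.dom →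
      args j' ∈ θ'.dom ∧ MapsEqnAt ξ j j' (θ.toFun (args j)) (θ'.toFun (args j')) := by
    intro j j' hp hj
    obtain ⟨s, hs, hsat⟩ := Nondeg.exists_satisfiesAt (θ.nondeg _ hj) j
    obtain ⟨s', hs', hp2⟩ := hp.exists_image hξ hs
    have hj' : args j' ∈ θ'.dom :=
      ((heqn j s j' s' hs hs' hp2).1 ((mem_eqn_iff hs).2 ⟨hj, hsat⟩)).2.1
    refine ⟨hj', fun s s' hs hs' hp2 => ?_⟩
    have := heqn j s j' s' hs hs' hp2
    dsimp only at this
    rwa [mem_eqn_iff hs, mem_eqn_iff hs', and_iff_right hj, and_iff_right hj'] at this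
  have hback : ∀ {j j'}, Prolong1 ξ j j' → args j' ∈ θ'.dom → args j ∈ θ.dom := by
    intro j j' hp hj'
    obtain ⟨s', hs', hsat⟩ := Nondeg.exists_satisfiesAt (θ'.nondeg _ hj') j'
    obtain ⟨s, hs, hp2⟩ := hp.exists_preimage hξ hs'
    exact ((heqn j s j' s' hs hs' hp2).2 ((mem_eqn_iff hs').2 ⟨hj', hsat⟩)).2.1
  have hB : HasBaseForm ξ := by
    refine hasBaseForm_of_tot_time hξ fun w hw => ?_
    obtain ⟨z, hz, rfl⟩ := hdom w hw
    refine ⟨{p | args (z.1, p) ∈ θ.dom}, θ.isOpen_dom.preimage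
      (contDiff_args.continuous.comp (by fun_prop : Continuous fun p => ((z.1, p) : Jet1))),
      ⟨(zeroTimeJet z).2, hz⟩, fun p hp hpd => ?_⟩
    obtain ⟨j', hj'⟩ := hpd
    obtain ⟨h1, h2⟩ := hstep hj' hp
    exact h2.tot_time_eq_zero hξ hj' (θ.nondeg _ hp) (θ'.nondeg _ h1)
  have hval : ∀ {j j'}, Prolong1 ξ j j' → args j ∈ θ.dom →
      θ'.toFun (args j') = affElem (coefs ξ j) (θ.toFun (args j)) := by
    intro j j' hp hj
    have hp2 := hB.prolong1_setTime hp (j.2 0 + 1)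
    have hm := (hstep hp hj).2
    have hm2 := (hstep hp2 (by rwa [args_setTime])).2
    rw [args_setTime, args_setTime] at hm2
    exact hB.eq_affElem hp (θ.nondeg _ hj) (by simp) hp2 hm hm2
  refine ⟨equivTransform ξ hB, (hasEquivalenceForm_equivTransform hB).mem_equivalenceGroup,
    restrictsTo_equivTransform hB, fun z hz => ⟨hz.2, trivial⟩, ?_⟩
  apply Set.Subset.antisymm
  · rintro _ ⟨z, ⟨⟨hz1, hz2⟩, hz⟩, rfl⟩
    have hp := prolong1_prolongMap hξ hz
    refine ⟨⟨(hstep hp hz1).1, ?_⟩, ⟨_, hp.symm hξ⟩⟩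
    change affElem (coefs ξ z.1) z.2 = θ'.toFun (args (prolongMap ξ z.1))
    rw [hval hp hz1, hz2]
  · rintro z' ⟨⟨hz1, hz2⟩, j, hj⟩
    have hp := (prolong1_symm_iff hξ).1 hj
    have hd := hback hp hz1
    refine ⟨(j, θ.toFun (args j)), ⟨⟨hd, rfl⟩, ⟨_, hp⟩⟩, ?_⟩
    refine Prod.ext (hp.eq_prolongMap hξ).symm ?_
    rw [hz2, hval hp hd]
    rfl

end EvolClass

theorem theorem2p4 :
    EvolClass.IsNormalized ∧
    (∀ Ξ : OpenPartialHomeomorph EvolClass.Ext EvolClass.Ext,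
      Ξ ∈ EvolClass.equivalenceGroup ↔ EvolClass.HasEquivalenceForm Ξ) ∧
    (∀ ξ : OpenPartialHomeomorph EvolClass.Base EvolClass.Base, EvolClass.HasBaseForm ξ →
      ∃ Ξ ∈ EvolClass.equivalenceGroup, EvolClass.RestrictsTo Ξ ξ ∧
        Ξ.source = EvolClass.prolongDomain ξ ×ˢ Set.univ) :=
  ⟨EvolClass.isNormalized,
    fun _ => ⟨EvolClass.hasEquivalenceForm_of_mem_equivalenceGroup,
      EvolClass.HasEquivalenceForm.mem_equivalenceGroup⟩,
    fun ξ hB => ⟨EvolClass.equivTransform ξ hB,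
      (EvolClass.hasEquivalenceForm_equivTransform hB).mem_equivalenceGroup,
      EvolClass.restrictsTo_equivTransform hB, rfl⟩⟩
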